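/- Let $\Lambda$ be a Cohen-Macaulay artin algebra: an algebra that is finitely generated as a module over a commutative artinian ring, and that has a dualizing bimodule $\omega$. Here a $\Lambda$-bimodule $\omega$, finitely generated as a left module, is called dualizing if the adjoint pair of functors $(\omega\otimes_\Lambda -,\ \mathrm{Hom}_\Lambda(\omega,-))$ on finitely generated left $\Lambda$-modules restricts to inverse equivalences between the modules of finite injective dimension and the modules of finite projective dimension. Fix such an $\omega$. All modules are left modules. Let $\mathrm{Add}\,\omega$ be the class of all modules isomorphic to direct summands of (possibly infinite) direct sums of copies of $\omega$. A (not necessarily finitely generated) $\Lambda$-module $M$ is $\omega$-Gorenstein projective if there is an exact sequence $0\to M\to w_0\to w_1\to w_2\to\cdots$ with all $w_i\in\mathrm{Add}\,\omega$. A finitely generated $\omega$-Gorenstein projective module is called a Cohen-Macaulay (CM) module. An $\omega$-Gorenstein projective module is of finite CM-type if it is isomorphic to a direct sum of arbitrarily many copies of finitely many indecomposable CM modules. The algebra $\Lambda$ is of finite CM-type if there are, up to isomorphism, only finitely many indecomposable CM $\Lambda$-modules. **Theorem.** If there is an $\omega$-Gorenstein projective $\Lambda$-module $M$ which is not of finite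 CM-type, then there are indecomposable CM $\Lambda$-modules of arbitrarily large finite length: for every $b\in\mathbb N$ there is an indecomposable CM $\Lambda$-module $N$ with $b<\ell_\Lambda(N)<\infty$. **Corollary.** If there is a bound on the lengths of the indecomposable CM $\Lambda$-modules, then $\Lambda$ is of finite CM-type. -/

import Mathlib

open scoped TensorProduct DirectSum

universe u

namespace CMArtin

section Dualizing

/- Throughout, a `Λ`-bimodule `ω` is a left `Λ`-module with a commuting right action,
the right action being written as an action of `Λᵐᵒᵖ`. All unadorned modules are left modules. -/

variable (Λ : Type u) [Ring Λ]
variable (ω : Type u) [AddCommGroup ω] [Module Λ ω] [Module Λᵐᵒᵖ ω] [SMulCommClass Λ Λᵐᵒᵖ ω]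
variable (X : Type u) [AddCommGroup X] [Module Λ X]

/-- The relations `(w a) ⊗ x = w ⊗ (a x)` which cut the tensor product over `ℤ` down to the
tensor product over `Λ`. Their span is a submodule for the left action of `Λ` on `ω`. -/
def tensorRel : Submodule Λ (ω ⊗[ℤ] X) :=
  Submodule.span Λ
    {z | ∃ (w : ω) (a : Λ) (x : X), z = (MulOpposite.op a • w) ⊗ₜ[ℤ] x - w ⊗ₜ[ℤ] (a • x)}

/-- The left `Λ`-module `ω ⊗_Λ X`, for a `Λ`-bimodule `ω` and a left `Λ`-module `X`. -/
abbrev TensorOver : Type u := (ω ⊗[ℤ] X) ⧸ tensorRel Λ ω X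

/-- The abelian group `Hom_Λ(ω, X)` of homomorphisms of left modules, which is given below the
left `Λ`-action induced by the right action on `ω`. -/
def HomOver : Type u := ω →ₗ[Λ] X

instance : AddCommGroup (HomOver Λ ω X) := inferInstanceAs (AddCommGroup (ω →ₗ[Λ] X))

variable {Λ ω X} in
/-- A homomorphism, seen as an element of `Hom_Λ(ω, X)`. -/
def HomOver.of (f : ω →ₗ[Λ] X) : HomOver Λ ω X := f

variable {Λ ω X} in
/-- The homomorphism underlying an element of `Hom_Λ(ω, X)`. -/
def HomOver.toHom (f : HomOver Λ ω X) : ω →ₗ[Λ] X := f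

variable {Λ ω} in
/-- Right multiplication by `a`, as an endomorphism of the left module `ω`. -/
def rightMul (a : Λ) : ω →ₗ[Λ] ω where
  toFun w := MulOpposite.op a • w
  map_add' := smul_add _
  map_smul' b w := (smul_comm b (MulOpposite.op a) w).symm

/-- The left action `(a • f) w = f (w a)` of `Λ` on `Hom_Λ(ω, X)`. -/
instance : Module Λ (HomOver Λ ω X) where
  smul a f := HomOver.of (f.toHom ∘ₗ rightMul a)
  one_smul f := LinearMap.ext fun w => by
    change f.toHom (MulOpposite.op (1 : Λ) • w) = f.toHom w
    rw [MulOpposite.op_one, one_smul]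
  mul_smul a b f := LinearMap.ext fun w => by
    change f.toHom (MulOpposite.op (a * b) • w) =
      f.toHom (MulOpposite.op b • MulOpposite.op a • w)
    rw [MulOpposite.op_mul, mul_smul]
  smul_zero a := LinearMap.ext fun w => rfl
  smul_add a f g := LinearMap.ext fun w => rfl
  add_smul a b f := LinearMap.ext fun w => by
    change f.toHom (MulOpposite.op (a + b) • w) =
      f.toHom (MulOpposite.op a • w) + f.toHom (MulOpposite.op b • w)
    rw [MulOpposite.op_add, add_smul, map_add]
  zero_smul f := LinearMap.ext fun w => by
    change f.toHom (MulOpposite.op (0 : Λ) • w) = 0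
    rw [MulOpposite.op_zero, zero_smul, map_zero]

@[simp] theorem HomOver.smul_apply (a : Λ) (f : HomOver Λ ω X) (w : ω) :
    (a • f).toHom w = f.toHom (MulOpposite.op a • w) := rfl

/-- The evaluation map `w ⊗ f ↦ f w`, before passing to the tensor product over `Λ`. -/
def evalAux : ω ⊗[ℤ] HomOver Λ ω X →ₗ[Λ] X :=
  TensorProduct.AlgebraTensorModule.lift
    { toFun := fun w =>
        ((AddMonoidHom.mk' (fun f : HomOver Λ ω X => f.toHom w) fun _ _ => rfl).toIntLinearMap)
      map_add' := fun w w' => LinearMap.ext fun f => f.toHom.map_add w w'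
      map_smul' := fun a w => LinearMap.ext fun f => f.toHom.map_smul a w }

/-- The counit `ω ⊗_Λ Hom_Λ(ω, X) → X`, `w ⊗ f ↦ f w`, of the tensor-hom adjunction. -/
def counit : TensorOver Λ ω (HomOver Λ ω X) →ₗ[Λ] X :=
  (tensorRel Λ ω (HomOver Λ ω X)).liftQ (evalAux Λ ω X) <| by
    refine Submodule.span_le.2 ?_
    rintro _ ⟨w, a, f, rfl⟩
    change evalAux Λ ω X _ = 0
    rw [map_sub, sub_eq_zero]
    rfl

/-- The class of `w ⊗ x` in `ω ⊗_Λ X`. -/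
def tmulOver (w : ω) (x : X) : TensorOver Λ ω X := (tensorRel Λ ω X).mkQ (w ⊗ₜ[ℤ] x)

set_option linter.unusedSectionVars false in
theorem tmulOver_smul (w : ω) (a : Λ) (x : X) :
    tmulOver Λ ω X w (a • x) = tmulOver Λ ω X (MulOpposite.op a • w) x := by
  have h : (MulOpposite.op a • w) ⊗ₜ[ℤ] x - w ⊗ₜ[ℤ] (a • x) ∈ tensorRel Λ ω X :=
    Submodule.subset_span ⟨w, a, x, rfl⟩
  exact ((Submodule.Quotient.eq _).2 h).symm

/-- The unit `X → Hom_Λ(ω, ω ⊗_Λ X)`, `x ↦ (w ↦ w ⊗ x)`, of the tensor-hom adjunction. -/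
def unit : X →ₗ[Λ] HomOver Λ ω (TensorOver Λ ω X) where
  toFun x := HomOver.of
    { toFun := fun w => tmulOver Λ ω X w x
      map_add' := fun w w' => by simp only [tmulOver, TensorProduct.add_tmul, map_add]
      map_smul' := fun a w => by
        simp only [tmulOver, RingHom.id_apply, ← map_smul, TensorProduct.smul_tmul'] }
  map_add' x y := LinearMap.ext fun w => by
    change tmulOver Λ ω X w (x + y) = tmulOver Λ ω X w x + tmulOver Λ ω X w y
    simp only [tmulOver, TensorProduct.tmul_add, map_add]
  map_smul' a x := LinearMap.ext fun w => tmulOver_smul Λ ω X w a x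

/-- `X` belongs to `𝒫^∞(Λ)`: it is finitely generated, of finite projective dimension. -/
def IsFGFinProjDim : Prop :=
  Module.Finite Λ X ∧
    ∃ n : ℕ, CategoryTheory.HasProjectiveDimensionLE (ModuleCat.of Λ X) n

/-- `X` belongs to `ℐ^∞(Λ)`: it is finitely generated, of finite injective dimension. -/
def IsFGFinInjDim : Prop :=
  Module.Finite Λ X ∧
    ∃ n : ℕ, CategoryTheory.HasInjectiveDimensionLE (ModuleCat.of Λ X) n

/-- The bimodule `ω` is dualizing: it is finitely generated, and the adjoint pair of functors
`(ω ⊗_Λ -, Hom_Λ(ω, -))` restricts to inverse equivalences between the finitely generated modules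
of finite injective dimension and those of finite projective dimension, that is, each functor
carries the one class to the other, and the counit and the unit of the adjunction are isomorphisms
on these classes. An artin algebra is Cohen-Macaulay when it has a dualizing bimodule. -/
structure IsDualizing : Prop where
  finite : Module.Finite Λ ω
  hom_mem : ∀ (X : Type u) [AddCommGroup X] [Module Λ X],
    IsFGFinInjDim Λ X → IsFGFinProjDim Λ (HomOver Λ ω X)
  tensor_mem : ∀ (Y : Type u) [AddCommGroup Y] [Module Λ Y],
    IsFGFinProjDim Λ Y → IsFGFinInjDim Λ (TensorOver Λ ω Y)
  counit_bijective : ∀ (X : Type u) [AddCommGroup X] [Module Λ X],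
    IsFGFinInjDim Λ X → Function.Bijective (counit Λ ω X)
  unit_bijective : ∀ (Y : Type u) [AddCommGroup Y] [Module Λ Y],
    IsFGFinProjDim Λ Y → Function.Bijective (unit Λ ω Y)

end Dualizing

section GorensteinProjective

variable (Λ : Type u) [Ring Λ]
variable (ω : Type u) [AddCommGroup ω] [Module Λ ω]
variable (M : Type u) [AddCommGroup M] [Module Λ M]

/-- `M` belongs to `Add ω`: it is isomorphic to a direct summand of a (possibly infinite) direct
sum of copies of `ω`. -/
def IsInAdd : Prop :=
  ∃ (I : Type u) (i : M →ₗ[Λ] (I →₀ ω)) (p : (I →₀ ω) →ₗ[Λ] M), p ∘ₗ i = LinearMap.id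

/-- `M` is `ω`-Gorenstein projective: there is an exact sequence
`0 → M → w 0 → w 1 → w 2 → ⋯` with all `w n` in `Add ω`. -/
def IsGorensteinProjective : Prop :=
  ∃ (w : ℕ → ModuleCat.{u} Λ) (ε : M →ₗ[Λ] w 0) (d : ∀ n, w n →ₗ[Λ] w (n + 1)),
    (∀ n, IsInAdd Λ ω (w n)) ∧ Function.Injective ε ∧ Function.Exact ε (d 0) ∧
      ∀ n, Function.Exact (d n) (d (n + 1))

/-- `M` is an indecomposable module: it is nonzero, and in every decomposition into an (internal)
direct sum of two submodules one of them is zero. -/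
def IsIndecomposable : Prop :=
  Nontrivial M ∧ ∀ A B : Submodule Λ M, IsCompl A B → A = ⊥ ∨ B = ⊥

/-- `M` is an indecomposable Cohen-Macaulay module, that is, an indecomposable finitely generated
`ω`-Gorenstein projective module. -/
structure IsIndecomposableCM : Prop where
  finite : Module.Finite Λ M
  gorensteinProjective : IsGorensteinProjective Λ ω M
  indecomposable : IsIndecomposable Λ M

/-- `M` is of finite `CM`-type: it is a direct sum of arbitrarily many copies of finitely many
indecomposable Cohen-Macaulay modules. -/
def IsOfFiniteCMType : Prop :=
  ∃ (n : ℕ) (C : Fin n → ModuleCat.{u} Λ) (I : Type u) (c : I → Fin n),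
    (∀ j, IsIndecomposableCM Λ ω (C j)) ∧ Nonempty (M ≃ₗ[Λ] ⨁ i : I, C (c i))

/-- The algebra `Λ` is of finite `CM`-type: up to isomorphism, there are only finitely many
indecomposable Cohen-Macaulay modules. -/
def AlgebraIsOfFiniteCMType : Prop :=
  ∃ (n : ℕ) (C : Fin n → ModuleCat.{u} Λ),
    ∀ (N : Type u) [AddCommGroup N] [Module Λ N],
      IsIndecomposableCM Λ ω N → ∃ j, Nonempty (N ≃ₗ[Λ] C j)

end GorensteinProjective

end CMArtin

/-! Both claims follow from a bound `b` on the lengths of the indecomposable CM modules, the theorem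
by contraposition. Under such a bound the Harada–Sai lemma (`RadChain.eq_zero`) says that every
composite of `2 ^ b - 1` non-isomorphisms between indecomposable CM modules is zero: the radical of
the category of CM modules is nilpotent.

The dualizing bimodule enters as follows. `Hom(ω, -)` is exact on the finitely generated modules of
finite injective dimension (`IsDualizing.homMap_surjective`), so `ω` has no self-extensions, and a
finitely generated module is CM exactly when its positive `Ext` groups into `ω` vanish
(`IsDualizing.isGorensteinProjective`, `IsDualizing.extVanish`). Consequently CM modules are closed
under summands, and every finitely generated module has a right CM-approximation. Moreover every
homomorphism from a finitely generated module to an `ω`-Gorenstein projective `M` factors through a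
CM module (`IsDualizing.exists_factor`); in other words, `Hom(-, M)` is a flat functor on CM
modules.

Finiteness of the number of indecomposables: right almost split maps exist over an artin algebra
and, composed with approximations, give finite right almost split families of CM modules. Every
indecomposable CM module has a nonzero map to a summand of `ω`. Unfolding such a map through the
families for `2 ^ b - 1` levels either meets the source of the map, up to isomorphism, in a finite
list, or writes the map as a sum of composites that vanish by Harada–Sai.

Decomposition of `M`: over a ring with nilpotent radical, flat modules are projective, and the proof
carries this over to functors. A maximal family of homomorphisms from indecomposable CM modules to
`M`, independent modulo the radical, defines a map from a direct sum to `M`. It induces a surjection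
on homomorphisms from CM modules by Nakayama; by flatness the kernel of that surjection equals its
own radical, hence vanishes. Evaluating at the CM module `Λ` yields an isomorphism. -/

namespace CMArtin

/-! ### A finitely generated injective cogenerator over a commutative artinian ring. -/

section InjectiveCogenerator

/-- An injective homomorphism whose range meets every nonzero submodule of the target. -/
def IsEssential {A S N : Type*} [Ring A] [AddCommGroup S] [Module A S] [AddCommGroup N]
    [Module A N] (i : S →ₗ[A] N) : Prop :=
  Function.Injective i ∧ ∀ U : Submodule A N, U ⊓ LinearMap.range i = ⊥ → U = ⊥

theorem IsEssential.comp {A S N P : Type*} [Ring A] [AddCommGroup S] [Module A S]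
    [AddCommGroup N] [Module A N] [AddCommGroup P] [Module A P] {j : N →ₗ[A] P} {i : S →ₗ[A] N}
    (hj : IsEssential j) (hi : IsEssential i) : IsEssential (j ∘ₗ i) := by
  refine ⟨hj.1.comp hi.1, fun U hU => hj.2 U ?_⟩
  have h : U.comap j = ⊥ := hi.2 _ <| (Submodule.eq_bot_iff _).2 fun x hx => by
    obtain ⟨hx₁, s, rfl⟩ := hx
    have : j (i s) ∈ U ⊓ LinearMap.range (j ∘ₗ i) := ⟨hx₁, s, rfl⟩
    rw [hU, Submodule.mem_bot] at this
    exact hj.1 (by simpa using this)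
  refine (Submodule.eq_bot_iff _).2 ?_
  rintro _ ⟨hx, n, rfl⟩
  have : n ∈ U.comap j := hx
  rw [h, Submodule.mem_bot] at this
  rw [this, map_zero]

/-- Take `C` maximal among the submodules meeting the range of `j` trivially. A submodule of the
quotient that meets the image trivially pulls back to a competitor containing `C`, hence to `C`
itself. -/
theorem exists_isEssential_mkQ_comp {A S N : Type*} [Ring A] [AddCommGroup S] [Module A S]
    [AddCommGroup N] [Module A N] [IsNoetherian A N] (j : S →ₗ[A] N)
    (hj : Function.Injective j) : ∃ C : Submodule A N, IsEssential (C.mkQ ∘ₗ j) := by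
  obtain ⟨C, hC, hmax⟩ := (wellFounded_gt (α := Submodule A N)).has_min
    {C | C ⊓ LinearMap.range j = ⊥} ⟨⊥, bot_inf_eq _⟩
  refine ⟨C, ?_, fun U hU => ?_⟩
  · rw [injective_iff_map_eq_zero]
    intro s hs
    have : j s ∈ C ⊓ LinearMap.range j :=
      ⟨(Submodule.Quotient.mk_eq_zero C).1 hs, s, rfl⟩
    rw [show C ⊓ LinearMap.range j = ⊥ from hC, Submodule.mem_bot] at this
    exact hj (by simpa using this)
  · have hle : C ≤ U.comap C.mkQ := fun x hx => by
      rw [Submodule.mem_comap, Submodule.mkQ_apply, (Submodule.Quotient.mk_eq_zero C).2 hx]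
      exact U.zero_mem
    have hmem : U.comap C.mkQ ⊓ LinearMap.range j = ⊥ := (Submodule.eq_bot_iff _).2 <| by
      rintro _ ⟨hx, s, rfl⟩
      have h0 : C.mkQ (j s) ∈ U ⊓ LinearMap.range (C.mkQ ∘ₗ j) := ⟨hx, s, rfl⟩
      rw [hU, Submodule.mem_bot] at h0
      have : j s ∈ C ⊓ LinearMap.range j := ⟨(Submodule.Quotient.mk_eq_zero C).1 h0, s, rfl⟩
      rwa [show C ⊓ LinearMap.range j = ⊥ from hC] at this
    have heq : U.comap C.mkQ = C := by
      by_contra hne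
      exact hmax _ hmem (lt_of_le_of_ne hle (Ne.symm hne))
    rw [← Submodule.map_comap_eq_of_surjective C.mkQ_surjective U, heq]
    exact (Submodule.eq_bot_iff _).2 <| by
      rintro _ ⟨x, hx, rfl⟩
      exact (Submodule.Quotient.mk_eq_zero C).2 hx

variable {R : Type u} [CommRing R] [IsArtinianRing R]

instance isSemisimpleModule_quotient_jacobson :
    IsSemisimpleModule R (R ⧸ Ring.jacobson R) :=
  (IsArtinian.isSemisimpleModule_iff_jacobson R _).2 (Module.jacobson_quotient_jacobson R R)

/-- An element killed by the radical spans an image of the semisimple module `R ⧸ Ring.jacobson R`.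
A complement `V` of the preimage of the range maps to a submodule meeting the range trivially, which
is zero by essentiality. -/
theorem torsionBySet_jacobson_le_range {N : Type*} [AddCommGroup N] [Module R N]
    {i : (R ⧸ Ring.jacobson R) →ₗ[R] N} (hi : IsEssential i) :
    Submodule.torsionBySet R N (Ring.jacobson R : Set R) ≤ LinearMap.range i := by
  intro x hx
  have hx' : Ring.jacobson R ≤ LinearMap.ker (LinearMap.toSpanSingleton R N x) := fun a ha =>
    (Submodule.mem_torsionBySet_iff _ _).1 hx ⟨a, ha⟩
  set φ := (Ring.jacobson R).liftQ (LinearMap.toSpanSingleton R N x) hx'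
  obtain ⟨V, hV⟩ := exists_isCompl ((LinearMap.range i).comap φ)
  have h0 : V.map φ = ⊥ := hi.2 _ <| (Submodule.eq_bot_iff _).2 <| by
    rintro _ ⟨⟨v, hv, rfl⟩, hr⟩
    have : v ∈ (LinearMap.range i).comap φ ⊓ V := ⟨hr, hv⟩
    rw [hV.inf_eq_bot, Submodule.mem_bot] at this
    rw [this, map_zero]
  have hle : V ≤ (LinearMap.range i).comap φ := fun v hv => by
    have : φ v ∈ V.map φ := ⟨v, hv, rfl⟩
    rw [h0, Submodule.mem_bot] at this
    rw [Submodule.mem_comap, this]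
    exact Submodule.zero_mem _
  have htop : (LinearMap.range i).comap φ = ⊤ := by
    rw [← hV.sup_eq_top, sup_eq_left.2 hle]
  have h1 : (Submodule.Quotient.mk (1 : R) : R ⧸ Ring.jacobson R) ∈ (LinearMap.range i).comap φ := by
    rw [htop]; trivial
  have h2 : φ (Submodule.Quotient.mk 1) = x := one_smul R x
  rwa [Submodule.mem_comap, h2] at h1

/-- Write `J` for the radical. Multiplication maps the `J ^ (k + 1)`-torsion to `Hom(J ^ k,
J-torsion)` with kernel the `J ^ k`-torsion, and the `J`-torsion lies in the copy of `R ⧸ J`. As `J`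
is nilpotent, this bounds the length of all essential extensions of `R ⧸ J` at once. -/
theorem length_torsionBySet_jacobson_pow_le {N : Type u} [AddCommGroup N] [Module R N]
    {i : (R ⧸ Ring.jacobson R) →ₗ[R] N} (hi : IsEssential i) (k : ℕ) :
    Module.length R (Submodule.torsionBySet R N ((Ring.jacobson R ^ k : Ideal R) : Set R)) ≤
      ∑ j ∈ Finset.range k,
        Module.length R ((Ring.jacobson R ^ j : Ideal R) →ₗ[R] (R ⧸ Ring.jacobson R)) := by
  induction k with
  | zero =>
    have : Submodule.torsionBySet R N ((Ring.jacobson R ^ 0 : Ideal R) : Set R) = ⊥ := by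
      refine (Submodule.eq_bot_iff _).2 fun x hx => ?_
      simpa using (Submodule.mem_torsionBySet_iff _ _).1 hx ⟨1, by simp⟩
    rw [this]; simp
  | succ k ih =>
    rw [Finset.sum_range_succ]
    set T := Submodule.torsionBySet R N ((Ring.jacobson R ^ (k + 1) : Ideal R) : Set R)
    set T' := Submodule.torsionBySet R N ((Ring.jacobson R ^ k : Ideal R) : Set R)
    have hT : T' ≤ T := Submodule.torsionBySet_le_torsionBySet_pow k (k + 1) (Nat.le_succ k) _
    let e := LinearEquiv.ofInjective i hi.1
    let ψ : T →ₗ[R] ((Ring.jacobson R ^ k : Ideal R) →ₗ[R] LinearMap.range i) :=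
      { toFun := fun x =>
          { toFun := fun a => ⟨(a : R) • (x : N), torsionBySet_jacobson_le_range hi <|
              (Submodule.mem_torsionBySet_iff _ _).2 fun b => by
                rw [smul_smul]
                refine (Submodule.mem_torsionBySet_iff _ _).1 x.2 ⟨b * a, ?_⟩
                rw [pow_succ']
                exact Ideal.mul_mem_mul b.2 a.2⟩
            map_add' := fun a b => Subtype.ext (add_smul _ _ _)
            map_smul' := fun a b => Subtype.ext (mul_smul _ _ _) }
        map_add' := fun x y => LinearMap.ext fun a => Subtype.ext (smul_add _ _ _)
        map_smul' := fun r x => LinearMap.ext fun a => Subtype.ext (smul_comm _ _ _) }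
    have hex : Function.Exact (Submodule.inclusion hT) ψ := fun x => by
      constructor
      · intro hx
        refine ⟨⟨x, (Submodule.mem_torsionBySet_iff _ _).2 fun a => ?_⟩, rfl⟩
        exact congrArg Subtype.val (LinearMap.congr_fun hx a)
      · rintro ⟨y, rfl⟩
        exact LinearMap.ext fun a => Subtype.ext <|
          (Submodule.mem_torsionBySet_iff _ _).1 y.2 a
    rw [Module.length_eq_add_of_exact (P := LinearMap.range ψ) (Submodule.inclusion hT) (ψ.rangeRestrict)
      (Submodule.inclusion_injective hT) ψ.surjective_rangeRestrict
      (fun x => by rw [← hex x]; exact Subtype.ext_iff)]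
    refine add_le_add ih ?_
    refine (Module.length_le_of_injective _ (LinearMap.range ψ).subtype_injective).trans ?_
    exact (LinearEquiv.congrRight e.symm : ((Ring.jacobson R ^ k : Ideal R) →ₗ[R] LinearMap.range i) ≃ₗ[R] _).length_eq.le

theorem exists_length_bound_of_isEssential : ∃ b : ℕ, ∀ (N : Type u) [AddCommGroup N] [Module R N]
    (i : (R ⧸ Ring.jacobson R) →ₗ[R] N), IsEssential i → Module.length R N ≤ b := by
  obtain ⟨k, hk⟩ := IsSemiprimaryRing.isNilpotent (R := R)
  have hne : (∑ j ∈ Finset.range k,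
      Module.length R ((Ring.jacobson R ^ j : Ideal R) →ₗ[R] (R ⧸ Ring.jacobson R))) ≠ ⊤ := by
    refine WithTop.sum_ne_top.2 fun j _ => ?_
    exact Module.length_ne_top
  obtain ⟨b, hb⟩ := ENat.ne_top_iff_exists.1 hne
  refine ⟨b, fun N _ _ i hi => ?_⟩
  rw [hb]
  refine le_trans ?_ (length_torsionBySet_jacobson_pow_le hi k)
  rw [hk, ← Module.length_top (R := R) (M := N)]
  refine Module.length_le_of_injective (Submodule.inclusion (fun x _ => ?_))
    (Submodule.inclusion_injective _)
  refine (Submodule.mem_torsionBySet_iff _ _).2 ?_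
  rintro ⟨a, ha⟩
  have ha0 : a = 0 := ha
  change a • x = 0
  rw [ha0, zero_smul]

/-- Baer's criterion: in the pushout of `g` and the inclusion of `I` into `R`, divide by a submodule
that makes `E` essential. Maximality of the length forces `E` to be the whole quotient, so `E` is a
retract of the pushout and `g` extends to `R`. -/
theorem injective_of_isEssential_of_forall_length_le {E : Type u} [AddCommGroup E] [Module R E]
    [Module.Finite R E] {i : (R ⧸ Ring.jacobson R) →ₗ[R] E} (hi : IsEssential i)
    (hmax : ∀ (N : Type u) [AddCommGroup N] [Module R N] [Module.Finite R N]
      (i : (R ⧸ Ring.jacobson R) →ₗ[R] N), IsEssential i → Module.length R N ≤ Module.length R E) :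
    Module.Injective R E := by
  refine Module.Baer.injective fun I g => ?_
  let K : Submodule R (E × R) := LinearMap.range (g.prod (-I.subtype))
  let j : E →ₗ[R] (E × R) ⧸ K := K.mkQ ∘ₗ LinearMap.inl R E R
  have hj : Function.Injective j := by
    rw [injective_iff_map_eq_zero]
    intro e he
    obtain ⟨x, hx⟩ := (Submodule.Quotient.mk_eq_zero K).1 he
    have h1 : g x = e := congrArg Prod.fst hx
    have h2 : -(x : R) = 0 := congrArg Prod.snd hx
    rw [← h1, show x = 0 from Subtype.ext (neg_eq_zero.1 h2), map_zero]
  obtain ⟨C, hC⟩ := exists_isEssential_mkQ_comp j hj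
  have hlen := hmax _ _ (hC.comp hi)
  have hsurj : Function.Surjective (C.mkQ ∘ₗ j) := by
    have h := Module.length_eq_add_of_exact (C.mkQ ∘ₗ j) (LinearMap.range (C.mkQ ∘ₗ j)).mkQ hC.1
      (Submodule.mkQ_surjective _) (LinearMap.exact_map_mkQ_range _)
    rw [h] at hlen
    have h0 : Module.length R ((((E × R) ⧸ K) ⧸ C) ⧸ LinearMap.range (C.mkQ ∘ₗ j)) = 0 := by
      have hne : Module.length R E ≠ ⊤ := Module.length_ne_top
      by_contra h0
      exact absurd hlen (not_le.2 (add_comm (Module.length R E) _ ▸ ENat.lt_add_left hne (pos_iff_ne_zero.2 h0)))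
    rw [Module.length_eq_zero_iff, Submodule.Quotient.subsingleton_iff] at h0
    exact LinearMap.range_eq_top.1 h0
  let e := LinearEquiv.ofBijective (C.mkQ ∘ₗ j) ⟨hC.1, hsurj⟩
  refine ⟨e.symm.toLinearMap ∘ₗ C.mkQ ∘ₗ K.mkQ ∘ₗ LinearMap.inr R E R, fun x hx => ?_⟩
  have : K.mkQ (LinearMap.inr R E R x) = j (g ⟨x, hx⟩) :=
    ((Submodule.Quotient.eq K).2 ⟨⟨x, hx⟩, by simp⟩).symm
  simp only [LinearMap.comp_apply, this]
  exact e.symm_apply_apply _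

variable (R) in
theorem exists_finite_injective_cogenerator : ∃ (E : Type u) (_ : AddCommGroup E) (_ : Module R E),
    Module.Finite R E ∧ Module.Injective R E ∧
      ∀ I : Ideal R, I ≠ ⊤ → ∃ f : R →ₗ[R] E, (∀ x ∈ I, f x = 0) ∧ f 1 ≠ 0 := by
  obtain ⟨b, hb⟩ := exists_length_bound_of_isEssential (R := R)
  let p : ℕ → Prop := fun n => ∃ (E : Type u) (_ : AddCommGroup E) (_ : Module R E)
    (_ : Module.Finite R E) (i : (R ⧸ Ring.jacobson R) →ₗ[R] E),
      IsEssential i ∧ Module.length R E = n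
  have hcast : ∀ (E : Type u) [AddCommGroup E] [Module R E] [Module.Finite R E],
      ∃ n : ℕ, Module.length R E = n := fun E _ _ _ =>
    (ENat.ne_top_iff_exists.1 (Module.length_ne_top (R := R) (M := E))).imp fun _ h => h.symm
  have hp : ∃ n, p n := by
    obtain ⟨n, hn⟩ := hcast (R ⧸ Ring.jacobson R)
    exact ⟨n, _, _, _, inferInstance, LinearMap.id,
      ⟨Function.injective_id, fun U hU => by simpa using hU⟩, hn⟩
  classical
  obtain ⟨n, hn⟩ := hp
  have hbound : ∀ m, p m → m ≤ b := by
    rintro m ⟨E, _, _, _, i, hi, hE⟩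
    have := hb E i hi
    rw [hE] at this
    exact_mod_cast this
  have hmem : p (Nat.findGreatest p b) := Nat.findGreatest_spec (hbound n hn) hn
  obtain ⟨E, _, _, _, i, hi, hE⟩ := hmem
  refine ⟨E, _, _, ‹_›, injective_of_isEssential_of_forall_length_le hi fun N _ _ _ i' hi' => ?_,
    fun I hI => ?_⟩
  · obtain ⟨m, hm⟩ := hcast N
    have hpm : p m := ⟨N, _, _, ‹_›, i', hi', hm⟩
    rw [hm, hE]
    exact_mod_cast Nat.le_findGreatest (hbound m hpm) hpm
  -- A complement of the image of `m` in the semisimple `R ⧸ Ring.jacobson R` is nonzero and killed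
  -- by `m`; any nonzero element `v` of it gives the required map `1 ↦ i v`.
  · obtain ⟨m, hm, hIm⟩ := Ideal.exists_le_maximal I hI
    let U : Submodule R (R ⧸ Ring.jacobson R) := Submodule.map (Ring.jacobson R).mkQ m
    have hU : U ≠ ⊤ := fun h => by
      have h1 : (Ring.jacobson R).mkQ 1 ∈ U := h ▸ Submodule.mem_top
      obtain ⟨x, hx, hx1⟩ := h1
      have h2 : x - 1 ∈ Ring.jacobson R := (Submodule.Quotient.eq _).1 hx1
      have h3 : x - 1 ∈ m := by
        have : Ring.jacobson R ≤ m := by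
          rw [← Ideal.jacobson_bot]
          exact sInf_le ⟨bot_le, hm⟩
        exact this h2
      exact hm.ne_top ((Ideal.eq_top_iff_one _).2 (by simpa using m.sub_mem hx h3))
    obtain ⟨V, hV⟩ := exists_isCompl U
    have hV0 : V ≠ ⊥ := fun h => hU (by simpa [h] using hV.sup_eq_top)
    obtain ⟨v, hv, hv0⟩ := Submodule.exists_mem_ne_zero_of_ne_bot hV0
    refine ⟨LinearMap.toSpanSingleton R E (i v), fun x hx => ?_, fun h => hv0 ?_⟩
    · have hxv : x • v ∈ U := by
        obtain ⟨r, rfl⟩ := Submodule.Quotient.mk_surjective _ v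
        exact ⟨x * r, m.mul_mem_right r (hIm hx), rfl⟩
      have : x • v ∈ U ⊓ V := ⟨hxv, V.smul_mem x hv⟩
      rw [hV.inf_eq_bot, Submodule.mem_bot] at this
      rw [LinearMap.toSpanSingleton_apply, ← map_smul, this, map_zero]
    · exact hi.1 (by simpa using h)

end InjectiveCogenerator

/-! ### Indecomposable modules of finite length, and the Harada–Sai lemma. -/

section Indecomposable

variable {Λ : Type u} [Ring Λ]

section

variable {X Y Z : Type u} [AddCommGroup X] [Module Λ X] [AddCommGroup Y] [Module Λ Y]
  [AddCommGroup Z] [Module Λ Z]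

theorem IsIndecomposable.of_linearEquiv (h : IsIndecomposable Λ X) (e : X ≃ₗ[Λ] Y) :
    IsIndecomposable Λ Y := by
  have := h.1
  refine ⟨e.injective.nontrivial, fun A B hAB => ?_⟩
  have hc : IsCompl (A.comap e.toLinearMap) (B.comap e.toLinearMap) :=
    hAB.map (Submodule.orderIsoMapComap e).symm
  refine (h.2 _ _ hc).imp (fun h0 => ?_) (fun h0 => ?_)
  all_goals
    exact (Submodule.orderIsoMapComap e).symm.injective (h0.trans (OrderIso.map_bot _).symm)

/-- A homomorphism into an indecomposable module which has a nonzero retract as source is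
bijective. -/
theorem IsIndecomposable.bijective_of_comp_bijective [Nontrivial X] (hY : IsIndecomposable Λ Y)
    (f : X →ₗ[Λ] Y) (g : Y →ₗ[Λ] X) (h : Function.Bijective (g ∘ₗ f)) :
    Function.Bijective f ∧ Function.Bijective g := by
  have hf : Function.Injective f := Function.Injective.of_comp (f := g) h.1
  have hc : IsCompl (LinearMap.range f) (LinearMap.ker g) := by
    rw [isCompl_iff, disjoint_iff, codisjoint_iff]
    constructor
    · refine (Submodule.eq_bot_iff _).2 ?_
      rintro _ ⟨⟨x, rfl⟩, hx⟩
      have : x = 0 := h.1 (by simpa using hx)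
      rw [this, map_zero]
    · refine eq_top_iff.2 fun y _ => ?_
      obtain ⟨x, hx⟩ := h.2 (g y)
      rw [← add_sub_cancel (f x) y]
      exact Submodule.add_mem_sup ⟨x, rfl⟩ (by simpa [sub_eq_zero] using hx.symm)
  rcases hY.2 _ _ hc with h0 | h0
  · obtain ⟨x, hx⟩ := exists_ne (0 : X)
    refine absurd (hf ?_) hx
    have : f x ∈ LinearMap.range f := ⟨x, rfl⟩
    rw [h0, Submodule.mem_bot] at this
    rw [this, map_zero]
  · have hg : Function.Injective g := LinearMap.ker_eq_bot.1 h0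
    have hfs : Function.Surjective f := by
      rw [← LinearMap.range_eq_top, ← hc.sup_eq_top, h0, sup_bot_eq]
    exact ⟨⟨hf, hfs⟩, hg, Function.Surjective.of_comp (g := f) h.2⟩

variable [IsArtinianRing Λ]

/-- Fitting's lemma: for large `n` the kernel and the range of `f ^ n` are complementary, so one of
them is zero. -/
theorem IsIndecomposable.bijective_or_isNilpotent [Module.Finite Λ X] (hX : IsIndecomposable Λ X)
    (f : Module.End Λ X) : Function.Bijective f ∨ IsNilpotent f := by
  obtain ⟨n, hn, hpos⟩ :=
    ((LinearMap.eventually_isCompl_ker_pow_range_pow f).and (Filter.eventually_ge_atTop 1)).exists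
  rcases hX.2 _ _ hn with h | h
  · left
    have hinj : Function.Injective (f ^ n) := LinearMap.ker_eq_bot.1 h
    refine IsArtinian.bijective_of_injective_endomorphism f ?_
    obtain ⟨m, rfl⟩ := Nat.exists_eq_add_of_le' hpos
    rw [pow_succ] at hinj
    exact Function.Injective.of_comp (f := (f ^ m : Module.End Λ X)) hinj
  · right
    exact ⟨n, LinearMap.range_eq_bot.1 h⟩

/-- The endomorphism ring is local. After composing with the inverse `e.symm` of the sum, a
nonbijective `f` becomes nilpotent, and one minus it, which is `g` composed with `e.symm`, is a
unit. -/
theorem IsIndecomposable.bijective_of_add [Module.Finite Λ X] (hX : IsIndecomposable Λ X)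
    {f g : Module.End Λ X} (h : Function.Bijective (f + g)) :
    Function.Bijective f ∨ Function.Bijective g := by
  let e := LinearEquiv.ofBijective (f + g) h
  by_contra! hfg
  have hf : IsNilpotent (e.symm.toLinearMap ∘ₗ f : Module.End Λ X) := by
    refine (hX.bijective_or_isNilpotent _).resolve_left fun hb => hfg.1 ?_
    have := e.bijective.comp hb
    convert this using 1
    ext x
    simp
  have hu : IsUnit (1 - (e.symm.toLinearMap ∘ₗ f : Module.End Λ X)) := hf.isUnit_one_sub
  rw [Module.End.isUnit_iff] at hu
  refine hfg.2 ?_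
  convert e.bijective.comp hu using 1
  ext x
  have : e x = f x + g x := rfl
  simp [this]

end

/-- A finitely generated module is a finite direct sum of indecomposable modules. -/
theorem exists_decomposition [IsArtinianRing Λ] (X : Type u) [AddCommGroup X] [Module Λ X]
    [Module.Finite Λ X] : ∃ (n : ℕ) (C : Fin n → ModuleCat.{u} Λ),
      (∀ j, Module.Finite Λ (C j) ∧ IsIndecomposable Λ (C j)) ∧ Nonempty (X ≃ₗ[Λ] ∀ j, C j) := by
  suffices H : ∀ (b : ℕ) (X : Type u) [AddCommGroup X] [Module Λ X] [Module.Finite Λ X],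
      Module.length Λ X ≤ b → ∃ (n : ℕ) (C : Fin n → ModuleCat.{u} Λ),
      (∀ j, Module.Finite Λ (C j) ∧ IsIndecomposable Λ (C j)) ∧ Nonempty (X ≃ₗ[Λ] ∀ j, C j) by
    obtain ⟨b, hb⟩ := ENat.ne_top_iff_exists.1 (Module.length_ne_top (R := Λ) (M := X))
    exact H b X hb.ge
  intro b
  induction b using Nat.strong_induction_on with
  | _ b ih =>
  intro X _ _ _ hb
  by_cases hX : IsIndecomposable Λ X
  · exact ⟨1, fun _ => ModuleCat.of Λ X, fun _ => ⟨‹_›, hX⟩,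
      ⟨(LinearEquiv.funUnique (Fin 1) Λ X).symm⟩⟩
  rcases subsingleton_or_nontrivial X with h0 | h0
  · exact ⟨0, Fin.elim0, fun j => j.elim0, ⟨⟨0, 0, fun x => Subsingleton.elim _ _,
      fun x => Subsingleton.elim _ _⟩⟩⟩
  obtain ⟨A, B, hAB, hA, hB⟩ : ∃ A B : Submodule Λ X, IsCompl A B ∧ A ≠ ⊥ ∧ B ≠ ⊥ := by
    by_contra! h
    exact hX ⟨h0, fun A B hAB => or_iff_not_imp_left.2 (h A B hAB)⟩
  have hlen := (Submodule.prodEquivOfIsCompl A B hAB).length_eq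
  rw [Module.length_prod] at hlen
  obtain ⟨a, ha⟩ := ENat.ne_top_iff_exists.1 (Module.length_ne_top (R := Λ) (M := A))
  obtain ⟨c, hc⟩ := ENat.ne_top_iff_exists.1 (Module.length_ne_top (R := Λ) (M := B))
  rw [← ha, ← hc] at hlen
  have hpa : 0 < a := by
    have := (Module.length_pos_iff (R := Λ)).2 (Submodule.nontrivial_iff_ne_bot.2 hA)
    rw [← ha] at this
    exact_mod_cast this
  have hpc : 0 < c := by
    have := (Module.length_pos_iff (R := Λ)).2 (Submodule.nontrivial_iff_ne_bot.2 hB)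
    rw [← hc] at this
    exact_mod_cast this
  have hle : a + c ≤ b := by
    rw [← hlen] at hb
    exact_mod_cast hb
  obtain ⟨n, C, hC, ⟨e⟩⟩ := ih a (by omega) A ha.ge
  obtain ⟨m, D, hD, ⟨f⟩⟩ := ih c (by omega) B hc.ge
  let G : Fin n ⊕ Fin m → ModuleCat.{u} Λ := Sum.elim C D
  refine ⟨n + m, fun j => G (finSumFinEquiv.symm j), fun j => ?_, ⟨?_⟩⟩
  · change Module.Finite Λ (G (finSumFinEquiv.symm j)) ∧
      IsIndecomposable Λ (G (finSumFinEquiv.symm j))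
    rcases finSumFinEquiv.symm j with i | i
    exacts [hC i, hD i]
  · exact (Submodule.prodEquivOfIsCompl A B hAB).symm ≪≫ₗ (e.prodCongr f) ≪≫ₗ
      (LinearEquiv.sumPiEquivProdPi Λ (Fin n) (Fin m) (fun i => G i)).symm ≪≫ₗ
      (LinearEquiv.piCongrLeft Λ (fun i => G i) finSumFinEquiv.symm).symm

section Length

variable {X Y : Type*} [AddCommGroup X] [Module Λ X] [AddCommGroup Y] [Module Λ Y]
  [IsArtinian Λ Y] [IsNoetherian Λ Y]

theorem surjective_of_length_le (f : X →ₗ[Λ] Y) (hf : Function.Injective f)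
    (h : Module.length Λ Y ≤ Module.length Λ X) : Function.Surjective f := by
  have hadd := Module.length_eq_add_of_exact f (LinearMap.range f).mkQ hf
    (Submodule.mkQ_surjective _) (LinearMap.exact_map_mkQ_range f)
  have hne : Module.length Λ X ≠ ⊤ :=
    ne_top_of_le_ne_top (Module.length_ne_top (R := Λ) (M := Y)) (Module.length_le_of_injective f hf)
  rw [hadd] at h
  have h0 : Module.length Λ (Y ⧸ LinearMap.range f) = 0 := by
    by_contra h0
    exact absurd h (not_le.2
      (add_comm (Module.length Λ X) _ ▸ ENat.lt_add_left hne (pos_iff_ne_zero.2 h0)))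
  rw [Module.length_eq_zero_iff, Submodule.Quotient.subsingleton_iff] at h0
  exact LinearMap.range_eq_top.1 h0

theorem injective_of_length_le (f : X →ₗ[Λ] Y) (hf : Function.Surjective f)
    (h : Module.length Λ X ≤ Module.length Λ Y) : Function.Injective f := by
  have hadd := Module.length_eq_add_of_exact (LinearMap.ker f).subtype f
    (Submodule.subtype_injective _) hf (LinearMap.exact_subtype_ker_map f)
  rw [hadd] at h
  have h0 : Module.length Λ (LinearMap.ker f) = 0 := by
    by_contra h0
    exact absurd h (not_le.2 (ENat.lt_add_left (Module.length_ne_top (R := Λ) (M := Y))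
      (pos_iff_ne_zero.2 h0)))
  rw [Module.length_eq_zero_iff, Submodule.subsingleton_iff_eq_bot] at h0
  exact LinearMap.ker_eq_bot.1 h0

end Length

section HaradaSai

variable (P : ModuleCat.{u} Λ → Prop)

/-- `RadChain P k X Y f` says that `f` is a composite of `k` non-isomorphisms between modules
satisfying `P`. -/
inductive RadChain : ℕ → (X Y : ModuleCat.{u} Λ) → (X →ₗ[Λ] Y) → Prop
  | refl (X : ModuleCat.{u} Λ) (hX : P X) : RadChain 0 X X LinearMap.id
  | cons {k : ℕ} {X Y Z : ModuleCat.{u} Λ} (r : X →ₗ[Λ] Y) (f : Y →ₗ[Λ] Z) (hX : P X)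
      (hr : ¬ Function.Bijective r) (hf : RadChain k Y Z f) : RadChain (k + 1) X Z (f ∘ₗ r)

variable {P}

theorem RadChain.source_mem {k : ℕ} {X Y : ModuleCat.{u} Λ} {f : X →ₗ[Λ] Y}
    (h : RadChain P k X Y f) : P X := by
  cases h <;> assumption

theorem RadChain.target_mem {k : ℕ} {X Y : ModuleCat.{u} Λ} {f : X →ₗ[Λ] Y}
    (h : RadChain P k X Y f) : P Y := by
  induction h <;> assumption

theorem RadChain.snoc {k : ℕ} {X Y Z : ModuleCat.{u} Λ} {f : X →ₗ[Λ] Y}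
    (h : RadChain P k X Y f) (r : Y →ₗ[Λ] Z) (hZ : P Z) (hr : ¬ Function.Bijective r) :
    RadChain P (k + 1) X Z (r ∘ₗ f) := by
  induction h with
  | refl X hX => exact .cons r LinearMap.id hX hr (.refl Z hZ)
  | cons s f hX hs _ ih => exact .cons s (r ∘ₗ f) hX hs (ih r hr)

theorem RadChain.split {k l : ℕ} {X Z : ModuleCat.{u} Λ} {f : X →ₗ[Λ] Z}
    (h : RadChain P (k + l) X Z f) : ∃ (Y : ModuleCat.{u} Λ) (g : X →ₗ[Λ] Y) (g' : Y →ₗ[Λ] Z),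
      RadChain P k X Y g ∧ RadChain P l Y Z g' ∧ f = g' ∘ₗ g := by
  induction k generalizing X f with
  | zero => exact ⟨X, LinearMap.id, f, .refl X h.source_mem, by simpa using h, rfl⟩
  | succ k ih =>
    rw [Nat.add_right_comm] at h
    cases h with
    | cons r f hX hr hf =>
      obtain ⟨Y, g, g', hg, hg', rfl⟩ := ih hf
      exact ⟨Y, g ∘ₗ r, g', .cons r g hX hr hg, hg', rfl⟩

variable [IsArtinianRing Λ]

/-- The Harada–Sai lemma, in terms of the length of the range. -/
theorem RadChain.length_range_le (hP : ∀ X, P X → Module.Finite Λ X ∧ IsIndecomposable Λ X)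
    {b : ℕ} (hb : ∀ X, P X → Module.length Λ X ≤ b) (m : ℕ) {X Y : ModuleCat.{u} Λ}
    {f : X →ₗ[Λ] Y} (h : RadChain P (2 ^ m - 1) X Y f) :
    f = 0 ∨ Module.length Λ (LinearMap.range f) + m ≤ b := by
  induction m generalizing X Y f with
  | zero =>
    right
    simpa using (Module.length_le_of_injective _ (LinearMap.range f).subtype_injective).trans
      (hb Y h.target_mem)
  | succ m ih =>
    by_contra! hcon
    obtain ⟨hf0, hlt⟩ := hcon
    -- The chain consists of two chains `g`, `g'` of length `2 ^ m - 1` with a single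
    -- non-isomorphism `h` between them.
    have h2 : 2 ^ (m + 1) - 1 = (2 ^ m - 1) + ((2 ^ m - 1) + 1) := by
      have := Nat.one_le_two_pow (n := m)
      rw [pow_succ]; omega
    rw [h2] at h
    obtain ⟨Y₁, g, g₁, hg, hg₁, rfl⟩ := h.split
    clear h
    cases hg₁ with
    | @cons _ _ Z _ h g' hY₁ hh hg' =>
    have hg0 := (ih hg).resolve_left (by rintro rfl; simp at hf0)
    have hg0' := (ih hg').resolve_left (by rintro rfl; simp at hf0)
    have := (hP _ hg.source_mem).1
    have := (hP _ hg'.target_mem).1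
    obtain ⟨c, hc⟩ := ENat.ne_top_iff_exists.1
      (Module.length_ne_top (R := Λ) (M := LinearMap.range ((g' ∘ₗ h) ∘ₗ g)))
    have hlt' : b < c + (m + 1) := by
      rw [← hc] at hlt
      exact_mod_cast hlt
    -- If the claim fails, the range of the whole composite has length at least `b - m`, which by
    -- induction bounds the lengths of the ranges of `g` and `g'`. So all three lengths agree.
    have hle : ∀ l : ℕ∞, l + m ≤ b → l ≤ Module.length Λ (LinearMap.range ((g' ∘ₗ h) ∘ₗ g)) := by
      intro l hl
      induction l using ENat.recTopCoe with
      | top => simp at hl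
      | coe l =>
        rw [← hc]
        have : l + m ≤ b := by exact_mod_cast hl
        exact_mod_cast (by omega : l ≤ c)
    have hrange : LinearMap.range g' = LinearMap.range ((g' ∘ₗ h) ∘ₗ g) := by
      have hsub : LinearMap.range ((g' ∘ₗ h) ∘ₗ g) ≤ LinearMap.range g' := by
        rintro _ ⟨x, rfl⟩
        exact ⟨h (g x), rfl⟩
      refine le_antisymm (fun y hy => ?_) hsub
      obtain ⟨x, hx⟩ := surjective_of_length_le (Submodule.inclusion hsub)
        (Submodule.inclusion_injective hsub) (hle _ hg0') ⟨y, hy⟩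
      have hxy : (x : Y) = y := congrArg Subtype.val hx
      exact hxy ▸ x.2
    have hinj : ∀ x, g' (h (g x)) = 0 → g x = 0 := by
      intro x hx
      let φ : LinearMap.range g →ₗ[Λ] LinearMap.range ((g' ∘ₗ h) ∘ₗ g) :=
        ((g' ∘ₗ h).domRestrict (LinearMap.range g)).codRestrict _ (by
          rintro ⟨_, x, rfl⟩
          exact ⟨x, rfl⟩)
      have hφ : Function.Injective φ := injective_of_length_le φ (by
        rintro ⟨_, x, rfl⟩
        exact ⟨⟨g x, x, rfl⟩, rfl⟩) (hle _ hg0)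
      have : (⟨g x, x, rfl⟩ : LinearMap.range g) = 0 := hφ (Subtype.ext (by simpa [φ] using hx))
      exact congrArg Subtype.val this
    -- Since `g' ∘ₗ h` is injective on the range of `g` and has the same range as the composite, the
    -- range of `g` splits off `Y₁`; likewise the range of `h` splits off `Z`. Indecomposability
    -- then makes `h` bijective, a contradiction.
    have hc₁ : IsCompl (LinearMap.range g) (LinearMap.ker (g' ∘ₗ h)) := by
      rw [isCompl_iff, disjoint_iff, codisjoint_iff]
      constructor
      · refine (Submodule.eq_bot_iff _).2 ?_
        rintro _ ⟨⟨x, rfl⟩, hx⟩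
        exact hinj x hx
      · refine eq_top_iff.2 fun y _ => ?_
        have : g' (h y) ∈ LinearMap.range ((g' ∘ₗ h) ∘ₗ g) := hrange ▸ ⟨h y, rfl⟩
        obtain ⟨x, hx⟩ := this
        rw [← add_sub_cancel (g x) y]
        exact Submodule.add_mem_sup ⟨x, rfl⟩ (by simpa [sub_eq_zero] using hx.symm)
    have hk₁ : LinearMap.ker (g' ∘ₗ h) = ⊥ := by
      refine ((hP _ hY₁).2.2 _ _ hc₁).resolve_left fun h0 => hf0 ?_
      rw [LinearMap.range_eq_bot.1 h0, LinearMap.comp_zero]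
    have hgh : Function.Injective (g' ∘ₗ h) := LinearMap.ker_eq_bot.1 hk₁
    have hc₂ : IsCompl (LinearMap.range h) (LinearMap.ker g') := by
      rw [isCompl_iff, disjoint_iff, codisjoint_iff]
      constructor
      · refine (Submodule.eq_bot_iff _).2 ?_
        rintro _ ⟨⟨y, rfl⟩, hy⟩
        have : y = 0 := hgh (by simpa using hy)
        rw [this, map_zero]
      · refine eq_top_iff.2 fun z _ => ?_
        have : g' z ∈ LinearMap.range ((g' ∘ₗ h) ∘ₗ g) := hrange ▸ ⟨z, rfl⟩
        obtain ⟨x, hx⟩ := this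
        rw [← add_sub_cancel (h (g x)) z]
        exact Submodule.add_mem_sup ⟨g x, rfl⟩ (by simpa [sub_eq_zero] using hx.symm)
    have hk₂ : LinearMap.ker g' = ⊥ := by
      refine ((hP _ hg'.source_mem).2.2 _ _ hc₂).resolve_left fun h0 => hf0 ?_
      rw [LinearMap.range_eq_bot.1 h0, LinearMap.comp_zero, LinearMap.zero_comp]
    refine hh ⟨Function.Injective.of_comp (f := g') hgh, ?_⟩
    rw [← LinearMap.range_eq_top, ← hc₂.sup_eq_top, hk₂, sup_bot_eq]

/-- The Harada–Sai lemma. -/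
theorem RadChain.eq_zero (hP : ∀ X, P X → Module.Finite Λ X ∧ IsIndecomposable Λ X)
    {b : ℕ} (hb : ∀ X, P X → Module.length Λ X ≤ b) {X Y : ModuleCat.{u} Λ}
    {f : X →ₗ[Λ] Y} (h : RadChain P (2 ^ b - 1) X Y f) : f = 0 := by
  refine (h.length_range_le hP hb).elim id fun hle => ?_
  have := (hP _ h.target_mem).1
  obtain ⟨c, hc⟩ := ENat.ne_top_iff_exists.1
    (Module.length_ne_top (R := Λ) (M := LinearMap.range f))
  have h0 : Module.length Λ (LinearMap.range f) = 0 := by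
    rw [← hc] at hle ⊢
    have : c + b ≤ b := by exact_mod_cast hle
    exact_mod_cast (by omega : c = 0)
  rw [Module.length_eq_zero_iff, Submodule.subsingleton_iff_eq_bot] at h0
  exact LinearMap.range_eq_bot.1 h0

end HaradaSai

end Indecomposable

/-! ### Coinduced modules. -/

section Coinduced

variable (R Λ E : Type u) [CommRing R] [Ring Λ] [Algebra R Λ] [AddCommGroup E] [Module R E]

/-- The coinduced module `Hom_R(Λ, E)`, a left `Λ`-module through `(a • φ) x = φ (x a)`. -/
def Coind : Type u := Λ →ₗ[R] E

instance : AddCommGroup (Coind R Λ E) := inferInstanceAs (AddCommGroup (Λ →ₗ[R] E))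

instance : FunLike (Coind R Λ E) Λ E := inferInstanceAs (FunLike (Λ →ₗ[R] E) Λ E)

instance : Module Λ (Coind R Λ E) where
  smul a φ := (show Λ →ₗ[R] E from φ) ∘ₗ LinearMap.mulRight R a
  one_smul φ := LinearMap.ext fun x => congrArg φ (mul_one x)
  mul_smul a b φ := LinearMap.ext fun x => congrArg φ (mul_assoc x a b).symm
  smul_zero _ := LinearMap.ext fun _ => rfl
  smul_add _ _ _ := LinearMap.ext fun _ => rfl
  add_smul a b φ := LinearMap.ext fun x =>
    (congrArg φ (mul_add x a b)).trans (map_add (show Λ →ₗ[R] E from φ) _ _)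
  zero_smul φ := LinearMap.ext fun x =>
    (congrArg φ (mul_zero x)).trans (map_zero (show Λ →ₗ[R] E from φ))

variable {R Λ E}

theorem Coind.smul_apply (a : Λ) (φ : Coind R Λ E) (x : Λ) : (a • φ) x = φ (x * a) := rfl

theorem Coind.ext {φ ψ : Coind R Λ E} (h : ∀ x, φ x = ψ x) : φ = ψ := LinearMap.ext h

variable (R Λ E) in
/-- Evaluation at an element `x`, as a homomorphism of abelian groups. -/
def Coind.eval (x : Λ) : Coind R Λ E →+ E := AddMonoidHom.mk' (fun φ => φ x) fun _ _ => rfl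

section

variable {X Y : Type*} [AddCommGroup X] [Module R X] [Module Λ X] [IsScalarTower R Λ X]

/-- The homomorphism into the coinduced module which belongs to an `R`-linear form. -/
def Coind.lift (ν : X →ₗ[R] E) : X →ₗ[Λ] Coind R Λ E where
  toFun x := (show Λ →ₗ[R] E from ν ∘ₗ (LinearMap.toSpanSingleton Λ X x).restrictScalars R)
  map_add' x y := LinearMap.ext fun r => by
    change ν (r • (x + y)) = ν (r • x) + ν (r • y)
    rw [smul_add, map_add]
  map_smul' a x := LinearMap.ext fun r => by
    change ν (r • a • x) = ν ((r * a) • x)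
    rw [mul_smul]

theorem Coind.lift_apply (ν : X →ₗ[R] E) (x : X) (r : Λ) : Coind.lift (Λ := Λ) ν x r = ν (r • x) :=
  rfl

/-- The `R`-linear form which belongs to a homomorphism into the coinduced module. -/
def Coind.form (f : X →ₗ[Λ] Coind R Λ E) : X →ₗ[R] E where
  toFun x := f x 1
  map_add' x y := by rw [map_add]; rfl
  map_smul' r x := by
    rw [← algebraMap_smul Λ r x, map_smul, Coind.smul_apply, one_mul, ← mul_one (algebraMap R Λ r),
      ← Algebra.smul_def]
    exact map_smul (show Λ →ₗ[R] E from f x) r 1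

theorem Coind.form_apply (f : X →ₗ[Λ] Coind R Λ E) (x : X) : Coind.form f x = f x 1 := rfl

end

/-- The endomorphism of the coinduced module given by left multiplication in the argument. -/
def Coind.precomp (c : Λ) : Coind R Λ E →ₗ[Λ] Coind R Λ E where
  toFun φ := (show Λ →ₗ[R] E from φ) ∘ₗ LinearMap.mulLeft R c
  map_add' _ _ := LinearMap.ext fun _ => rfl
  map_smul' a φ := LinearMap.ext fun x => congrArg φ (mul_assoc c x a)

/-- Restriction of scalars of a `Λ`-module to `R` is compatible with the action of `Λ`. -/
theorem isScalarTower_compHom (X : Type*) [AddCommGroup X] [Module Λ X] :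
    let := Module.compHom X (algebraMap R Λ)
    IsScalarTower R Λ X :=
  let := Module.compHom X (algebraMap R Λ)
  ⟨fun r a x => by rw [Algebra.smul_def, mul_smul]; rfl⟩

/-- By the adjunction of `Coind.lift` and `Coind.form`, extending a homomorphism into the coinduced
module amounts to extending an `R`-linear form into `E`. -/
theorem Coind.injective (hE : Module.Injective R E) : Module.Injective Λ (Coind R Λ E) where
  out X Y _ _ _ _ i hi f := by
    let := Module.compHom X (algebraMap R Λ)
    let := Module.compHom Y (algebraMap R Λ)
    have := isScalarTower_compHom (R := R) (Λ := Λ) X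
    have := isScalarTower_compHom (R := R) (Λ := Λ) Y
    obtain ⟨g, hg⟩ := hE.out (i.restrictScalars R) hi (Coind.form f)
    refine ⟨Coind.lift g, fun x => Coind.ext fun r => ?_⟩
    rw [Coind.lift_apply, ← map_smul]
    refine (hg (r • x)).trans ?_
    rw [Coind.form_apply, map_smul, Coind.smul_apply, one_mul]

end Coinduced

/-! ### Approximations, injective embeddings and right almost split maps over artin algebras. -/

section ArtinAlgebra

variable (R : Type u) {Λ : Type u} [CommRing R] [Ring Λ] [Algebra R Λ]

/-- Over an artin algebra, a pair of finitely generated modules `X`, `Y` admits a homomorphism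
`X → Y ^ m` through which all homomorphisms `X → Y` factor. -/
theorem exists_left_approximation [IsArtinianRing R] [Module.Finite R Λ]
    (X Y : Type u) [AddCommGroup X] [Module Λ X] [Module.Finite Λ X]
    [AddCommGroup Y] [Module Λ Y] [Module.Finite Λ Y] :
    ∃ (m : ℕ) (φ : X →ₗ[Λ] (Fin m → Y)), ∀ f : X →ₗ[Λ] Y, ∃ g : (Fin m → Y) →ₗ[Λ] Y,
      g ∘ₗ φ = f := by
  let := Module.compHom X (algebraMap R Λ)
  let := Module.compHom Y (algebraMap R Λ)
  have := isScalarTower_compHom (R := R) (Λ := Λ) X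
  have := isScalarTower_compHom (R := R) (Λ := Λ) Y
  have : Module.Finite R X := Module.Finite.trans Λ X
  have : Module.Finite R Y := Module.Finite.trans Λ Y
  let ρ : (X →ₗ[Λ] Y) →ₗ[R] (X →ₗ[R] Y) := LinearMap.restrictScalarsₗ R Λ X Y R
  have hfin : Module.Finite R (X →ₗ[Λ] Y) :=
    Module.Finite.of_injective ρ (LinearMap.restrictScalars_injective R)
  obtain ⟨m, s, hs⟩ := Module.Finite.exists_fin (R := R) (M := X →ₗ[Λ] Y)
  refine ⟨m, LinearMap.pi s, fun f => ?_⟩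
  have hf : f ∈ Submodule.span R (Set.range s) := hs ▸ Submodule.mem_top
  obtain ⟨c, rfl⟩ := (Submodule.mem_span_range_iff_exists_fun R).1 hf
  refine ⟨∑ i, c i • LinearMap.proj i, LinearMap.ext fun x => ?_⟩
  simp [LinearMap.sum_apply]

variable {R} in
-- The cogenerator condition on ideals treats the cyclic submodule `R x`; injectivity of `E` extends
-- the form to `X`.
theorem exists_linearMap_apply_ne_zero {E : Type u} [AddCommGroup E] [Module R E]
    (hE : Module.Injective R E)
    (hco : ∀ I : Ideal R, I ≠ ⊤ → ∃ f : R →ₗ[R] E, (∀ x ∈ I, f x = 0) ∧ f 1 ≠ 0)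
    {X : Type u} [AddCommGroup X] [Module R X] (x : X) (hx : x ≠ 0) :
    ∃ f : X →ₗ[R] E, f x ≠ 0 := by
  let I : Ideal R := LinearMap.ker (LinearMap.toSpanSingleton R X x)
  obtain ⟨f, hf, hf1⟩ := hco I fun h => hx <| by
    have : (1 : R) ∈ I := h ▸ Submodule.mem_top
    simpa [I] using this
  let j : (R ⧸ I) →ₗ[R] X := I.liftQ (LinearMap.toSpanSingleton R X x) le_rfl
  have hj : Function.Injective j := by
    rw [← LinearMap.ker_eq_bot]
    exact Submodule.ker_liftQ_eq_bot _ _ _ le_rfl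
  obtain ⟨g, hg⟩ := hE.out j hj (I.liftQ f hf)
  refine ⟨g, ?_⟩
  have : j (Submodule.Quotient.mk 1) = x := one_smul R x
  rw [← this, hg]
  exact hf1

theorem Coind.finite [IsArtinianRing R] [Module.Finite R Λ] (E : Type u) [AddCommGroup E]
    [Module R E] [Module.Finite R E] : Module.Finite Λ (Coind R Λ E) := by
  have h1 : Module.Finite R (Λ →ₗ[R] E) := inferInstance
  obtain ⟨s, hs⟩ := h1.fg_top
  refine ⟨⟨s, eq_top_iff.2 fun φ _ => ?_⟩⟩
  suffices H : ∀ ψ : Λ →ₗ[R] E, ψ ∈ Submodule.span R (s : Set (Λ →ₗ[R] E)) →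
      (show Coind R Λ E from ψ) ∈ Submodule.span Λ (show Set (Coind R Λ E) from (s : Set (Λ →ₗ[R] E))) from
    H φ (hs ▸ Submodule.mem_top)
  intro ψ hψ
  induction hψ using Submodule.span_induction with
  | mem x hx => exact Submodule.subset_span hx
  | zero => exact Submodule.zero_mem _
  | add x y _ _ hx hy => exact Submodule.add_mem _ hx hy
  | smul r x _ hx =>
    have : (r • x : Λ →ₗ[R] E) =
        (algebraMap R Λ r • (show Coind R Λ E from x) : Coind R Λ E) := by
      refine LinearMap.ext fun a => ?_
      change r • x a = x (a * algebraMap R Λ r)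
      rw [← Algebra.commutes, ← Algebra.smul_def, map_smul]
    rw [this]
    exact Submodule.smul_mem _ _ hx

/-- Over an artin algebra, finitely generated modules embed in finitely generated injective
modules. -/
theorem exists_embedding_injective [IsArtinianRing R] [Module.Finite R Λ]
    (X : Type u) [AddCommGroup X] [Module Λ X] [Module.Finite Λ X] :
    ∃ (I : ModuleCat.{u} Λ) (i : X →ₗ[Λ] I), Module.Finite Λ I ∧ Module.Injective Λ I ∧
      Function.Injective i := by
  obtain ⟨E, _, _, _, hE, hco⟩ := exists_finite_injective_cogenerator R
  have : Module.Finite Λ (Coind R Λ E) := Coind.finite R E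
  obtain ⟨m, φ, hφ⟩ := exists_left_approximation R (Λ := Λ) X (Coind R Λ E)
  have hI := Coind.injective (Λ := Λ) hE
  refine ⟨ModuleCat.of Λ (Fin m → Coind R Λ E), φ, inferInstance,
    inferInstanceAs (Module.Injective Λ (Fin m → Coind R Λ E)), ?_⟩
  rw [injective_iff_map_eq_zero]
  intro x hx
  by_contra hx0
  let := Module.compHom X (algebraMap R Λ)
  have := isScalarTower_compHom (R := R) (Λ := Λ) X
  obtain ⟨f, hf⟩ := exists_linearMap_apply_ne_zero hE hco x hx0
  obtain ⟨g, hg⟩ := hφ (Coind.lift f)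
  apply hf
  have h1 := congrArg (fun ψ : Coind R Λ E => ψ 1) (LinearMap.congr_fun hg x)
  simp only [LinearMap.comp_apply, hx, map_zero, Coind.lift_apply, one_smul] at h1
  exact h1.symm

/-- The endomorphism ring is local, so the nonbijective endomorphisms form an `R`-submodule, and `E`
separates the identity from it. The form serves to detect split epimorphisms onto `Z`. -/
theorem exists_form_vanishing_on_not_bijective [IsArtinianRing Λ] {E : Type u} [AddCommGroup E]
    [Module R E] (hE : Module.Injective R E)
    (hco : ∀ I : Ideal R, I ≠ ⊤ → ∃ f : R →ₗ[R] E, (∀ x ∈ I, f x = 0) ∧ f 1 ≠ 0)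
    {Z : Type u} [AddCommGroup Z] [Module Λ Z] [Module R Z] [IsScalarTower R Λ Z]
    [Module.Finite Λ Z] (hZ : IsIndecomposable Λ Z) :
    ∃ ev : (Z →ₗ[Λ] Z) →ₗ[R] E, (∀ f : Z →ₗ[Λ] Z, ¬ Function.Bijective f → ev f = 0) ∧
      ev LinearMap.id ≠ 0 := by
  have := hZ.1
  let N : Submodule R (Z →ₗ[Λ] Z) :=
    { carrier := {f | ¬ Function.Bijective f}
      zero_mem' := fun h => by
        obtain ⟨x, hx⟩ := exists_ne (0 : Z)
        exact hx (h.1 rfl)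
      add_mem' := fun {f g} hf hg h => (hZ.bijective_of_add (f := f) (g := g) h).elim hf hg
      smul_mem' := fun r f hf h => hf ⟨fun x y hxy => h.1 (congrArg (r • ·) hxy), fun y => by
        obtain ⟨x, hx⟩ := h.2 y
        refine ⟨r • x, ?_⟩
        rw [← hx, LinearMap.smul_apply, ← algebraMap_smul Λ r x, map_smul, algebraMap_smul]⟩ }
  have hid : (Submodule.Quotient.mk LinearMap.id : (Z →ₗ[Λ] Z) ⧸ N) ≠ 0 := fun h =>
    (Submodule.Quotient.mk_eq_zero N).1 h Function.bijective_id
  obtain ⟨f, hf⟩ := exists_linearMap_apply_ne_zero hE hco _ hid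
  refine ⟨f ∘ₗ N.mkQ, fun g hg => ?_, hf⟩
  rw [LinearMap.comp_apply, N.mkQ_apply, (Submodule.Quotient.mk_eq_zero N).2 hg, map_zero]

/-- Over an artin algebra, every finitely generated indecomposable module is the target of a right
almost split homomorphism. -/
theorem exists_right_almost_split [IsArtinianRing R] [Module.Finite R Λ] (Z : Type u)
    [AddCommGroup Z] [Module Λ Z] [Module.Finite Λ Z] (hZ : IsIndecomposable Λ Z) :
    ∃ (B : ModuleCat.{u} Λ) (p : B →ₗ[Λ] Z), Module.Finite Λ B ∧
      (¬ ∃ s : Z →ₗ[Λ] B, p ∘ₗ s = LinearMap.id) ∧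
      ∀ (W : Type u) [AddCommGroup W] [Module Λ W] (g : W →ₗ[Λ] Z),
        (¬ ∃ s : Z →ₗ[Λ] W, g ∘ₗ s = LinearMap.id) → ∃ g' : W →ₗ[Λ] B, p ∘ₗ g' = g := by
  have := IsArtinianRing.of_finite R Λ
  obtain ⟨E, _, _, _, hE, hco⟩ := exists_finite_injective_cogenerator R
  have : Module.Finite Λ (Coind R Λ E) := Coind.finite R E
  let := Module.compHom Z (algebraMap R Λ)
  have := isScalarTower_compHom (R := R) (Λ := Λ) Z
  obtain ⟨ev, hev, hev1⟩ := exists_form_vanishing_on_not_bijective R hE hco hZ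
  obtain ⟨a, z, hz⟩ := Module.Finite.exists_fin (R := Λ) (M := Z)
  let π : (Fin a → Λ) →ₗ[Λ] Z := Fintype.linearCombination Λ z
  have hπ : Function.Surjective π := by
    rw [← LinearMap.range_eq_top, Fintype.range_linearCombination, hz]
  obtain ⟨b, r, hr⟩ := Submodule.fg_iff_exists_fin_generating_family.1
    (IsNoetherian.noetherian (LinearMap.ker π))
  -- An endomorphism is determined by its values at the generators, so `ev` extends to a form `lam`
  -- on `Z ^ a`, which is adjoint to `h`.
  let evz : (Z →ₗ[Λ] Z) →ₗ[R] (Fin a → Z) :=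
    { toFun := fun f i => f (z i)
      map_add' := fun _ _ => rfl
      map_smul' := fun _ _ => rfl }
  have hevz : Function.Injective evz := fun f g hfg => by
    refine LinearMap.ext_on_range hz fun i => congrFun hfg i
  obtain ⟨lam, hlam⟩ := hE.out evz hevz ev
  let h : Z →ₗ[Λ] (Fin a → Coind R Λ E) :=
    LinearMap.pi fun i => Coind.lift (lam ∘ₗ LinearMap.single R (fun _ => Z) i)
  -- This is the `E`-dual of the relation matrix; its kernel, which is also the kernel of `B → Z`
  -- below, plays the role of the Auslander–Reiten translate of `Z`.
  let κ : (Fin b → Coind R Λ E) →ₗ[Λ] (Fin a → Coind R Λ E) :=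
    LinearMap.pi fun i => ∑ j, Coind.precomp (r j i) ∘ₗ LinearMap.proj j
  have hκ : ∀ (φ : Fin b → Coind R Λ E) (i : Fin a) (c : Λ), κ φ i c = ∑ j, φ j (r j i * c) := by
    intro φ i c
    have : κ φ i = ∑ j, Coind.precomp (r j i) (φ j) := by simp [κ, LinearMap.sum_apply]
    rw [this]
    exact map_sum (Coind.eval R Λ E c) _ _
  -- Lifting `g : W → Z` to this pullback means finding `v` with `κ ∘ v = h ∘ g`; by adjunction, a
  -- form `ν` on `W ^ b` with `ν ∘ rel = μ`. The kernel of `rel` is `Hom(Z, W)`, where `μ` becomes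
  -- `f ↦ ev (g ∘ f)`. As `E` is injective, a lift exists as soon as this form is zero.
  let B : Submodule Λ (Z × (Fin b → Coind R Λ E)) :=
    LinearMap.eqLocus (h ∘ₗ LinearMap.fst Λ _ _) (κ ∘ₗ LinearMap.snd Λ _ _)
  refine ⟨ModuleCat.of Λ B, LinearMap.fst Λ _ _ ∘ₗ B.subtype, inferInstanceAs (Module.Finite Λ B),
    ?_, fun W _ _ g hg => ?_⟩
  · rintro ⟨s, hs⟩
    -- The components of a section express `ev LinearMap.id` through the values of `v j` at `∑ i, r
    -- j i • z i`, which vanish because `r j` is a relation.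
    let v : Fin b → Z →ₗ[Λ] Coind R Λ E := fun j =>
      LinearMap.proj j ∘ₗ LinearMap.snd Λ _ _ ∘ₗ B.subtype ∘ₗ s
    have hsingle : ∀ (i : Fin a) (x : Z), lam (Pi.single i x) = ∑ j, v j (r j i • x) 1 := by
      intro i x
      have h1 : h x i 1 = κ (fun j => v j x) i 1 := by
        have := (s x).2
        have h2 : h ((s x : Z × (Fin b → Coind R Λ E)).1) = κ (s x : Z × (Fin b → Coind R Λ E)).2 :=
          this
        have h3 : (s x : Z × (Fin b → Coind R Λ E)).1 = x := LinearMap.congr_fun hs x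
        rw [h3] at h2
        rw [h2]
        rfl
      rw [hκ] at h1
      have h4 : h x i 1 = lam (Pi.single i x) := by
        change lam (Pi.single i ((1 : Λ) • x)) = _
        rw [one_smul]
      rw [← h4, h1]
      refine Finset.sum_congr rfl fun j _ => ?_
      rw [map_smul, Coind.smul_apply, one_mul, mul_one]
    apply hev1
    rw [← hlam]
    have h5 : evz LinearMap.id = ∑ i, Pi.single i (z i) := (Finset.univ_sum_single z).symm
    rw [h5, map_sum]
    simp_rw [hsingle]
    rw [Finset.sum_comm]
    refine Finset.sum_eq_zero fun j _ => ?_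
    have h6 : π (r j) = 0 := by
      have : r j ∈ LinearMap.ker π := hr ▸ Submodule.subset_span ⟨j, rfl⟩
      exact this
    have h7 : ∑ i, r j i • z i = 0 := by
      simpa [π, Fintype.linearCombination_apply] using h6
    have h8 : (v j (∑ i, r j i • z i)) 1 = ∑ i, v j (r j i • z i) 1 := by
      rw [map_sum]
      exact map_sum (Coind.eval R Λ E 1) _ _
    rw [← h8, h7, map_zero]
    rfl
  · let := Module.compHom W (algebraMap R Λ)
    have := isScalarTower_compHom (R := R) (Λ := Λ) W
    let μ : (Fin a → W) →ₗ[R] E := lam ∘ₗ (g.restrictScalars R).compLeft (Fin a)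
    let rel : (Fin a → W) →ₗ[R] (Fin b → W) :=
      { toFun := fun w j => ∑ i, r j i • w i
        map_add' := fun w w' => funext fun j => by
          simp [smul_add, Finset.sum_add_distrib]
        map_smul' := fun c w => funext fun j => by
          simp [Finset.smul_sum, smul_algebra_smul_comm] }
    -- A tuple satisfying the relations consists of the values of some `f : Z → W` at the
    -- generators. As `g` does not split, `g ∘ₗ f` is not bijective and `ev` kills it.
    have hker : LinearMap.ker rel ≤ LinearMap.ker μ := by
      intro w hw
      let πw : (Fin a → Λ) →ₗ[Λ] W := Fintype.linearCombination Λ w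
      have hle : LinearMap.ker π ≤ LinearMap.ker πw := by
        rw [← hr, Submodule.span_le]
        rintro _ ⟨j, rfl⟩
        change πw (r j) = 0
        exact (Fintype.linearCombination_apply Λ w (r j)).trans (congrFun hw j)
      let f : Z →ₗ[Λ] W :=
        (LinearMap.ker π).liftQ πw hle ∘ₗ (π.quotKerEquivOfSurjective hπ).symm.toLinearMap
      have hf : ∀ i, f (z i) = w i := by
        intro i
        have h1 : z i = π.quotKerEquivOfSurjective hπ (Submodule.Quotient.mk (Pi.single i 1)) := by
          change z i = π (Pi.single i 1)
          simp [π]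
        change (LinearMap.ker π).liftQ πw hle ((π.quotKerEquivOfSurjective hπ).symm (z i)) = w i
        rw [h1, LinearEquiv.symm_apply_apply]
        change πw (Pi.single i 1) = w i
        simp [πw]
      have hgf : ¬ Function.Bijective (g ∘ₗ f) := fun hb => hg
        ⟨f ∘ₗ (LinearEquiv.ofBijective _ hb).symm.toLinearMap, LinearMap.ext fun x =>
          (LinearEquiv.ofBijective _ hb).apply_symm_apply x⟩
      change lam (fun i => g (w i)) = 0
      rw [← hev _ hgf, ← hlam]
      exact congrArg lam (funext fun i => congrArg g (hf i).symm)
    obtain ⟨ν, hν⟩ := hE.out ((LinearMap.ker rel).liftQ rel le_rfl)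
      (LinearMap.ker_eq_bot.1 (Submodule.ker_liftQ_eq_bot _ _ _ le_rfl))
      ((LinearMap.ker rel).liftQ μ hker)
    have hν' : ∀ w, ν (rel w) = μ w := fun w => hν (Submodule.Quotient.mk w)
    let v : W →ₗ[Λ] (Fin b → Coind R Λ E) :=
      LinearMap.pi fun j => Coind.lift (ν ∘ₗ LinearMap.single R (fun _ => W) j)
    refine ⟨(g.prod v).codRestrict B fun w => ?_, rfl⟩
    change h (g w) = κ (v w)
    refine funext fun i => Coind.ext fun c => ?_
    rw [hκ]
    have h1 : h (g w) i c = μ (Pi.single i (c • w)) := by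
      change lam (Pi.single i (c • g w)) = lam (g ∘ Pi.single i (c • w))
      rw [← map_smul]
      congr 1
      ext k
      rcases eq_or_ne k i with rfl | hk
      · simp
      · simp [hk]
    have h2 : rel (Pi.single i (c • w)) = ∑ j, Pi.single j ((r j i * c) • w) := by
      rw [Finset.univ_sum_single fun j => (r j i * c) • w]
      funext j
      change ∑ k, r j k • (Pi.single i (c • w) : Fin a → W) k = _
      rw [Finset.sum_eq_single i]
      · rw [Pi.single_eq_same, smul_smul]
      · intro k _ hk
        rw [Pi.single_eq_of_ne hk, smul_zero]
      · simp
    rw [h1, ← hν', h2, map_sum]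
    rfl

end ArtinAlgebra

/-! ### The tensor-hom adjunction of the bimodule. -/

section Adjunction

variable {Λ ω : Type u} [Ring Λ] [AddCommGroup ω] [Module Λ ω] [Module Λᵐᵒᵖ ω]
  [SMulCommClass Λ Λᵐᵒᵖ ω]
variable {X X' Y Y' : Type u} [AddCommGroup X] [Module Λ X] [AddCommGroup X'] [Module Λ X']
  [AddCommGroup Y] [Module Λ Y] [AddCommGroup Y'] [Module Λ Y']

set_option linter.unusedSectionVars false in
theorem tensorOver_induction {p : TensorOver Λ ω Y → Prop} (h0 : p 0)
    (ht : ∀ w y, p (tmulOver Λ ω Y w y)) (ha : ∀ s t, p s → p t → p (s + t)) (t) : p t := by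
  obtain ⟨t, rfl⟩ := Submodule.mkQ_surjective _ t
  induction t using TensorProduct.induction_on with
  | zero => rwa [map_zero]
  | tmul w y => exact ht w y
  | add s t hs ht => rw [map_add]; exact ha _ _ hs ht

theorem tensorOver_hom_ext {f g : TensorOver Λ ω Y →ₗ[Λ] X}
    (h : ∀ w y, f (tmulOver Λ ω Y w y) = g (tmulOver Λ ω Y w y)) : f = g :=
  LinearMap.ext fun t => tensorOver_induction (p := fun t => f t = g t) (by simp) h
    (fun s t hs ht => by rw [map_add, map_add, hs, ht]) t

set_option linter.unusedSectionVars false in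
theorem HomOver.ext {f g : HomOver Λ ω X} (h : ∀ w, f.toHom w = g.toHom w) : f = g :=
  LinearMap.ext h

/-- The homomorphism `ω ⊗_Λ Y → X` adjoint to `Y → Hom_Λ(ω, X)`. -/
def adj (h : Y →ₗ[Λ] HomOver Λ ω X) : TensorOver Λ ω Y →ₗ[Λ] X :=
  (tensorRel Λ ω Y).liftQ (evalAux Λ ω X ∘ₗ
    TensorProduct.AlgebraTensorModule.map (LinearMap.id : ω →ₗ[Λ] ω)
      h.toAddMonoidHom.toIntLinearMap) <| by
    refine Submodule.span_le.2 ?_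
    rintro _ ⟨w, a, y, rfl⟩
    change (evalAux Λ ω X ∘ₗ _) _ = 0
    rw [map_sub, sub_eq_zero]
    change (h y).toHom (MulOpposite.op a • w) = (h (a • y)).toHom w
    rw [show h (a • y) = a • h y from h.map_smul a y, HomOver.smul_apply]

variable (ω) in
/-- The functor `Hom_Λ(ω, -)` on homomorphisms. -/
def homMap (g : X →ₗ[Λ] X') : HomOver Λ ω X →ₗ[Λ] HomOver Λ ω X' where
  toFun f := HomOver.of (g ∘ₗ f.toHom)
  map_add' _ _ := HomOver.ext fun _ => map_add g _ _
  map_smul' _ _ := rfl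

variable (ω) in
/-- The functor `ω ⊗_Λ -` on homomorphisms. -/
def tensorMap (g : Y →ₗ[Λ] Y') : TensorOver Λ ω Y →ₗ[Λ] TensorOver Λ ω Y' :=
  adj (unit Λ ω Y' ∘ₗ g)

theorem tensorMap_surjective (g : Y →ₗ[Λ] Y') (hg : Function.Surjective g) :
    Function.Surjective (tensorMap ω g) := fun t =>
  tensorOver_induction (p := fun t => ∃ s, tensorMap ω g s = t) ⟨0, map_zero _⟩
    (fun w y => by
      obtain ⟨y, rfl⟩ := hg y
      exact ⟨tmulOver Λ ω Y w y, rfl⟩)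
    (fun s t ⟨s', hs⟩ ⟨t', ht⟩ => ⟨s' + t', by rw [map_add, hs, ht]⟩) t

theorem counit_comp_tensorMap_homMap (g : X →ₗ[Λ] X') :
    counit Λ ω X' ∘ₗ tensorMap ω (homMap ω g) = g ∘ₗ counit Λ ω X :=
  tensorOver_hom_ext fun _ _ => rfl

variable (Λ ω) in
/-- `ω ⊗_Λ Λ` is `ω`. -/
def tensorSelfEquiv : TensorOver Λ ω Λ ≃ₗ[Λ] ω :=
  LinearEquiv.ofLinearMap
    (adj
      { toFun := fun a => HomOver.of (rightMul a)
        map_add' := fun a b => HomOver.ext fun w => by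
          change MulOpposite.op (a + b) • w = MulOpposite.op a • w + MulOpposite.op b • w
          rw [MulOpposite.op_add, add_smul]
        map_smul' := fun a b => HomOver.ext fun w => by
          change MulOpposite.op (a * b) • w = MulOpposite.op b • MulOpposite.op a • w
          rw [MulOpposite.op_mul, mul_smul] })
    ((unit Λ ω Λ 1).toHom)
    (LinearMap.ext fun w => one_smul _ w)
    (tensorOver_hom_ext fun w a => by
      change tmulOver Λ ω Λ (MulOpposite.op a • w) 1 = tmulOver Λ ω Λ w a
      rw [← tmulOver_smul, smul_eq_mul, mul_one])

end Adjunction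

/-! ### Finite injective and projective dimension in short exact sequences. -/

section Dimension

open CategoryTheory

variable {Λ : Type u} [Ring Λ] {A B C : Type u} [AddCommGroup A] [Module Λ A]
  [AddCommGroup B] [Module Λ B] [AddCommGroup C] [Module Λ C]

theorem shortExact_of_exact (f : A →ₗ[Λ] B) (g : B →ₗ[Λ] C) (hf : Function.Injective f)
    (hg : Function.Surjective g) (h : Function.Exact f g) :
    (ShortComplex.mk (ModuleCat.ofHom f) (ModuleCat.ofHom g) (by
      ext x; exact (h (f x)).2 ⟨x, rfl⟩)).ShortExact where
  exact := (ShortComplex.ShortExact.moduleCat_exact_iff_function_exact _).2 h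
  mono_f := (ModuleCat.mono_iff_injective _).2 hf
  epi_g := (ModuleCat.epi_iff_surjective _).2 hg

theorem IsFGFinInjDim.of_linearEquiv (h : IsFGFinInjDim Λ A) (e : A ≃ₗ[Λ] B) :
    IsFGFinInjDim Λ B := by
  obtain ⟨h1, n, h2⟩ := h
  exact ⟨Module.Finite.equiv e, n, hasInjectiveDimensionLT_of_iso e.toModuleIso (n + 1)⟩

theorem isFGFinProjDim_self : IsFGFinProjDim Λ Λ :=
  ⟨inferInstance, 0, inferInstanceAs (HasProjectiveDimensionLT (ModuleCat.of Λ Λ) 1)⟩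

theorem injective_of_subsingleton [Subsingleton A] : Module.Injective Λ A := by
  constructor
  intros
  exact ⟨0, fun _ => Subsingleton.elim _ _⟩

theorem isFGFinInjDim_of_injective [Module.Finite Λ A] (h : Module.Injective Λ A) :
    IsFGFinInjDim Λ A := by
  have := (Module.injective_iff_injective_object Λ A).1 h
  exact ⟨inferInstance, 0, inferInstanceAs (HasInjectiveDimensionLT (ModuleCat.of Λ A) 1)⟩

section

variable {f : A →ₗ[Λ] B} {g : B →ₗ[Λ] C}

theorem IsFGFinInjDim.right (hA : IsFGFinInjDim Λ A) (hB : IsFGFinInjDim Λ B)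
    (hf : Function.Injective f) (hg : Function.Surjective g) (hfg : Function.Exact f g) :
    IsFGFinInjDim Λ C := by
  obtain ⟨_, n, hn⟩ := hA
  obtain ⟨_, m, hm⟩ := hB
  have := hasInjectiveDimensionLT_of_ge (ModuleCat.of Λ A) (n + 1) (n + m + 1 + 1) (by omega)
  have := hasInjectiveDimensionLT_of_ge (ModuleCat.of Λ B) (m + 1) (n + m + 1) (by omega)
  exact ⟨Module.Finite.of_surjective g hg, n + m,
    (shortExact_of_exact f g hf hg hfg).hasInjectiveDimensionLT_X₃ (n + m + 1) ‹_› ‹_›⟩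

theorem IsFGFinInjDim.middle (hA : IsFGFinInjDim Λ A) (hC : IsFGFinInjDim Λ C)
    (hf : Function.Injective f) (hg : Function.Surjective g) (hfg : Function.Exact f g) :
    IsFGFinInjDim Λ B := by
  obtain ⟨_, n, hn⟩ := hA
  obtain ⟨_, m, hm⟩ := hC
  have := hasInjectiveDimensionLT_of_ge (ModuleCat.of Λ A) (n + 1) (n + m + 1) (by omega)
  have := hasInjectiveDimensionLT_of_ge (ModuleCat.of Λ C) (m + 1) (n + m + 1) (by omega)
  exact ⟨Module.Finite.of_exact hfg hg, n + m,
    (shortExact_of_exact f g hf hg hfg).hasInjectiveDimensionLT_X₂ (n + m + 1) ‹_› ‹_›⟩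

theorem IsFGFinInjDim.left [IsNoetherianRing Λ] (hB : IsFGFinInjDim Λ B) (hC : IsFGFinInjDim Λ C)
    (hf : Function.Injective f) (hg : Function.Surjective g) (hfg : Function.Exact f g) :
    IsFGFinInjDim Λ A := by
  obtain ⟨_, n, hn⟩ := hB
  obtain ⟨_, m, hm⟩ := hC
  have := hasInjectiveDimensionLT_of_ge (ModuleCat.of Λ B) (n + 1) (n + m + 1 + 1) (by omega)
  have := hasInjectiveDimensionLT_of_ge (ModuleCat.of Λ C) (m + 1) (n + m + 1) (by omega)
  exact ⟨Module.Finite.of_injective f hf, n + m + 1,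
    (shortExact_of_exact f g hf hg hfg).hasInjectiveDimensionLT_X₁ (n + m + 1) ‹_› ‹_›⟩

theorem IsFGFinProjDim.right (hA : IsFGFinProjDim Λ A) (hB : IsFGFinProjDim Λ B)
    (hf : Function.Injective f) (hg : Function.Surjective g) (hfg : Function.Exact f g) :
    IsFGFinProjDim Λ C := by
  obtain ⟨_, n, hn⟩ := hA
  obtain ⟨_, m, hm⟩ := hB
  have := hasProjectiveDimensionLT_of_ge (ModuleCat.of Λ A) (n + 1) (n + m + 1) (by omega)
  have := hasProjectiveDimensionLT_of_ge (ModuleCat.of Λ B) (m + 1) (n + m + 1 + 1) (by omega)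
  exact ⟨Module.Finite.of_surjective g hg, n + m + 1,
    (shortExact_of_exact f g hf hg hfg).hasProjectiveDimensionLT_X₃ (n + m + 1) ‹_› ‹_›⟩

end

theorem IsFGFinInjDim.prod (hA : IsFGFinInjDim Λ A) (hB : IsFGFinInjDim Λ B) :
    IsFGFinInjDim Λ (A × B) :=
  hA.middle hB LinearMap.inl_injective LinearMap.snd_surjective .inl_snd

theorem IsFGFinInjDim.pi (hA : IsFGFinInjDim Λ A) (m : ℕ) : IsFGFinInjDim Λ (Fin m → A) := by
  induction m with
  | zero => exact isFGFinInjDim_of_injective injective_of_subsingleton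
  | succ m ih => exact (hA.prod ih).of_linearEquiv (Fin.consLinearEquiv Λ fun _ => A)

end Dimension

/-! ### Dimension shifting for vanishing of `Ext`. -/

section ExtVanishing

open CategoryTheory Abelian

variable {Λ : Type u} [Ring Λ] {A B C Y Z : Type u} [AddCommGroup A] [Module Λ A]
  [AddCommGroup B] [Module Λ B] [AddCommGroup C] [Module Λ C]
  [AddCommGroup Y] [Module Λ Y] [AddCommGroup Z] [Module Λ Z]

variable (Λ Y Z) in
/-- The groups `Ext^i(Y, Z)` vanish for all `i > k`. -/
def ExtVanish (k : ℕ) : Prop :=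
  ∀ i, k < i → ∀ e : Ext (ModuleCat.of Λ Y) (ModuleCat.of Λ Z) i, e = 0

theorem ExtVanish.mono {k l : ℕ} (h : ExtVanish Λ Y Z k) (hkl : k ≤ l) : ExtVanish Λ Y Z l :=
  fun i hi => h i (hkl.trans_lt hi)

theorem extVanish_of_projective [Module.Projective Λ Y] : ExtVanish Λ Y Z 0 := fun i hi e => by
  have : Projective (ModuleCat.of Λ Y) := (IsProjective.iff_projective Y).1 ‹_›
  obtain ⟨i, rfl⟩ := Nat.exists_eq_succ_of_ne_zero hi.ne'
  exact e.eq_zero_of_projective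

theorem extVanish_of_injectiveDimension {n : ℕ}
    (h : HasInjectiveDimensionLE (ModuleCat.of Λ Z) n) : ExtVanish Λ Y Z n := fun _ hi e =>
  have : HasInjectiveDimensionLT (ModuleCat.of Λ Z) (n + 1) := h
  e.eq_zero_of_hasInjectiveDimensionLT (n + 1) hi

theorem ExtVanish.retract_left {k : ℕ} (h : ExtVanish Λ Y Z k) (i : A →ₗ[Λ] Y) (p : Y →ₗ[Λ] A)
    (hpi : p ∘ₗ i = LinearMap.id) : ExtVanish Λ A Z k := fun n hn e => by
  have hid : ModuleCat.ofHom i ≫ ModuleCat.ofHom p = 𝟙 (ModuleCat.of Λ A) := by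
    rw [← ModuleCat.ofHom_comp, hpi]; rfl
  rw [← e.mk₀_id_comp, ← hid, ← Ext.mk₀_comp_mk₀, Ext.comp_assoc_of_second_deg_zero,
    h n hn ((Ext.mk₀ (ModuleCat.ofHom p)).comp e (zero_add n)), Ext.comp_zero]

theorem ExtVanish.retract_right {k : ℕ} (h : ExtVanish Λ Y Z k) (i : A →ₗ[Λ] Z) (p : Z →ₗ[Λ] A)
    (hpi : p ∘ₗ i = LinearMap.id) : ExtVanish Λ Y A k := fun n hn e => by
  have hid : ModuleCat.ofHom i ≫ ModuleCat.ofHom p = 𝟙 (ModuleCat.of Λ A) := by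
    rw [← ModuleCat.ofHom_comp, hpi]; rfl
  rw [← e.comp_mk₀_id, ← hid, ← Ext.mk₀_comp_mk₀, ← Ext.comp_assoc_of_second_deg_zero,
    h n hn (e.comp (Ext.mk₀ (ModuleCat.ofHom i)) (add_zero n)), Ext.zero_comp]

section

variable {f : A →ₗ[Λ] B} {g : B →ₗ[Λ] C}

theorem ExtVanish.left {k : ℕ} (hB : ExtVanish Λ B Z 0) (hC : ExtVanish Λ C Z (k + 1))
    (hf : Function.Injective f) (hg : Function.Surjective g) (hfg : Function.Exact f g) :
    ExtVanish Λ A Z k := fun i hi e => by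
  obtain ⟨x, rfl⟩ := Ext.contravariant_sequence_exact₁ (shortExact_of_exact f g hf hg hfg) _ e
    (add_comm 1 i) (hC _ (by omega) _)
  rw [hB i (by omega) x, Ext.comp_zero]

theorem ExtVanish.middle {k : ℕ} (hA : ExtVanish Λ A Z k) (hC : ExtVanish Λ C Z k)
    (hf : Function.Injective f) (hg : Function.Surjective g) (hfg : Function.Exact f g) :
    ExtVanish Λ B Z k := fun i hi e => by
  obtain ⟨x, rfl⟩ := Ext.contravariant_sequence_exact₂ (shortExact_of_exact f g hf hg hfg) _ e
    (hA _ hi _)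
  rw [hC i hi x, Ext.comp_zero]

/-- Only degree one needs `hsurj`: there a class comes from a homomorphism `A → Z`, and the
connecting map kills those that extend to `B`. -/
theorem ExtVanish.right (hA : ExtVanish Λ A Z 0) (hB : ExtVanish Λ B Z 0)
    (hf : Function.Injective f) (hg : Function.Surjective g) (hfg : Function.Exact f g)
    (hsurj : ∀ a : A →ₗ[Λ] Z, ∃ b : B →ₗ[Λ] Z, b ∘ₗ f = a) : ExtVanish Λ C Z 0 := fun i hi e => by
  obtain ⟨i, rfl⟩ := Nat.exists_eq_succ_of_ne_zero hi.ne'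
  obtain ⟨x, rfl⟩ := Ext.contravariant_sequence_exact₃ (shortExact_of_exact f g hf hg hfg) _ e
    (hB _ hi _) (add_comm 1 i)
  rcases Nat.eq_zero_or_pos i with rfl | hpos
  · obtain ⟨a, rfl⟩ := Ext.homEquiv₀.symm.surjective x
    obtain ⟨b, hb⟩ := hsurj a.hom
    have hab : a = ModuleCat.ofHom f ≫ ModuleCat.ofHom b := by
      ext x
      exact (LinearMap.congr_fun hb x).symm
    rw [Ext.homEquiv₀_symm_apply, hab, ← Ext.mk₀_comp_mk₀]
    exact (shortExact_of_exact f g hf hg hfg).extClass_comp_assoc _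
  · rw [hA i hpos x, Ext.comp_zero]

theorem ExtVanish.codomain_right (hA : ExtVanish Λ Y A 0) (hB : ExtVanish Λ Y B 0)
    (hf : Function.Injective f) (hg : Function.Surjective g) (hfg : Function.Exact f g) :
    ExtVanish Λ Y C 0 := fun i hi e => by
  obtain ⟨x, rfl⟩ := Ext.covariant_sequence_exact₃ _ (shortExact_of_exact f g hf hg hfg) e rfl
    (hA _ (by omega) _)
  rw [hB i hi x, Ext.zero_comp]

theorem ExtVanish.codomain_middle (hA : ExtVanish Λ Y A 0) (hC : ExtVanish Λ Y C 0)
    (hf : Function.Injective f) (hg : Function.Surjective g) (hfg : Function.Exact f g) :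
    ExtVanish Λ Y B 0 := fun i hi e => by
  obtain ⟨x, rfl⟩ := Ext.covariant_sequence_exact₂ _ (shortExact_of_exact f g hf hg hfg) e
    (hC _ hi _)
  rw [hA i hi x, Ext.zero_comp]

theorem ExtVanish.exists_lift (hA : ExtVanish Λ Y A 0)
    (hf : Function.Injective f) (hg : Function.Surjective g) (hfg : Function.Exact f g)
    (c : Y →ₗ[Λ] C) : ∃ b : Y →ₗ[Λ] B, g ∘ₗ b = c := by
  obtain ⟨x, hx⟩ := Ext.covariant_sequence_exact₃ _ (shortExact_of_exact f g hf hg hfg)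
    (Ext.mk₀ (ModuleCat.ofHom c)) (zero_add 1) (hA 1 one_pos _)
  obtain ⟨b, rfl⟩ := Ext.homEquiv₀.symm.surjective x
  rw [Ext.homEquiv₀_symm_apply, Ext.mk₀_comp_mk₀] at hx
  have := Ext.homEquiv₀.symm.injective (a₁ := b ≫ ModuleCat.ofHom g) (a₂ := ModuleCat.ofHom c) hx
  exact ⟨b.hom, congrArg ModuleCat.Hom.hom this⟩

theorem ExtVanish.codomain_left_succ (hB : Module.Injective Λ B) (k : ℕ)
    (hC : ∀ e : Ext (ModuleCat.of Λ Y) (ModuleCat.of Λ C) (k + 1), e = 0)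
    (hf : Function.Injective f) (hg : Function.Surjective g) (hfg : Function.Exact f g)
    (e : Ext (ModuleCat.of Λ Y) (ModuleCat.of Λ A) (k + 2)) : e = 0 := by
  have := (Module.injective_iff_injective_object Λ B).1 hB
  obtain ⟨x, rfl⟩ := Ext.covariant_sequence_exact₁ _ (shortExact_of_exact f g hf hg hfg) e
    (Ext.eq_zero_of_injective _) rfl
  rw [hC x, Ext.zero_comp]

theorem ExtVanish.codomain_left_one (hB : Module.Injective Λ B)
    (hf : Function.Injective f) (hg : Function.Surjective g) (hfg : Function.Exact f g)
    (hsurj : ∀ c : Y →ₗ[Λ] C, ∃ b : Y →ₗ[Λ] B, g ∘ₗ b = c)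
    (e : Ext (ModuleCat.of Λ Y) (ModuleCat.of Λ A) 1) : e = 0 := by
  have := (Module.injective_iff_injective_object Λ B).1 hB
  obtain ⟨x, rfl⟩ := Ext.covariant_sequence_exact₁ _ (shortExact_of_exact f g hf hg hfg) e
    (Ext.eq_zero_of_injective _) (zero_add 1)
  obtain ⟨c, rfl⟩ := Ext.homEquiv₀.symm.surjective x
  obtain ⟨b, hb⟩ := hsurj c.hom
  have hbc : c = ModuleCat.ofHom b ≫ ModuleCat.ofHom g := by
    ext x
    exact (LinearMap.congr_fun hb x).symm
  rw [Ext.homEquiv₀_symm_apply, hbc, ← Ext.mk₀_comp_mk₀, Ext.comp_assoc_of_second_deg_zero]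
  exact (congrArg (fun t => (Ext.mk₀ (ModuleCat.ofHom b)).comp t (zero_add 1))
    (shortExact_of_exact f g hf hg hfg).comp_extClass).trans (Ext.comp_zero _ _ _ _ _)

end

theorem ExtVanish.of_linearEquiv {k : ℕ} (h : ExtVanish Λ A Z k) (e : A ≃ₗ[Λ] B) :
    ExtVanish Λ B Z k :=
  h.retract_left e.symm.toLinearMap e.toLinearMap (LinearMap.ext e.apply_symm_apply)

theorem ExtVanish.prod {k : ℕ} (hA : ExtVanish Λ A Z k) (hB : ExtVanish Λ B Z k) :
    ExtVanish Λ (A × B) Z k :=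
  hA.middle hB LinearMap.inl_injective LinearMap.snd_surjective .inl_snd

theorem ExtVanish.pi (h : ExtVanish Λ A Z 0) (m : ℕ) : ExtVanish Λ (Fin m → A) Z 0 := by
  induction m with
  | zero => exact extVanish_of_projective
  | succ m ih => exact (h.prod ih).of_linearEquiv (Fin.consLinearEquiv Λ fun _ => A)

theorem ExtVanish.codomain_pi (h : ExtVanish Λ Y A 0) (m : ℕ) : ExtVanish Λ Y (Fin m → A) 0 := by
  induction m with
  | zero =>
    have : Module.Injective Λ (Fin 0 → A) := injective_of_subsingleton
    have := (Module.injective_iff_injective_object Λ (Fin 0 → A)).1 this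
    exact extVanish_of_injectiveDimension
      (inferInstanceAs (HasInjectiveDimensionLT (ModuleCat.of Λ (Fin 0 → A)) 1))
  | succ m ih =>
    let e := Fin.consLinearEquiv Λ fun _ : Fin (m + 1) => A
    exact (h.codomain_middle ih LinearMap.inl_injective LinearMap.snd_surjective
      .inl_snd).retract_right e.symm.toLinearMap e.toLinearMap (LinearMap.ext e.apply_symm_apply)

end ExtVanishing

/-! ### Artin algebras, independently of the base ring. -/

section ArtinAlgebraClass

/-- `Λ` is an artin algebra: it is finitely generated as a module over a commutative artinian
ring. -/
class IsArtinAlgebra (Λ : Type u) [Ring Λ] : Prop where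
  out : ∃ (R : Type u) (_ : CommRing R) (_ : IsArtinianRing R) (_ : Algebra R Λ), Module.Finite R Λ

/-- The ring `R` may live in another universe. The centre of `Λ` replaces it: it is finite over `R`,
hence artinian, and `Λ` is finite over it. -/
theorem IsArtinAlgebra.of_algebra (R : Type*) {Λ : Type u} [CommRing R] [IsArtinianRing R] [Ring Λ]
    [Algebra R Λ] [Module.Finite R Λ] : IsArtinAlgebra Λ := by
  let S := Subalgebra.center R Λ
  have : Module.Finite R S := Module.Finite.of_injective S.val.toLinearMap Subtype.val_injective
  have hfin : Module.Finite S Λ := Module.Finite.of_restrictScalars_finite R S Λ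
  exact ⟨S, inferInstance, IsArtinianRing.of_finite R _, RingHom.toAlgebra' S.val.toRingHom
    fun c x => (Subalgebra.mem_center_iff.1 c.2 x).symm, hfin⟩

instance {Λ : Type u} [Ring Λ] [h : IsArtinAlgebra Λ] : IsArtinianRing Λ := by
  obtain ⟨R, _, _, _, _⟩ := h.out
  exact IsArtinianRing.of_finite R Λ

end ArtinAlgebraClass

/-! ### Homological consequences of a dualizing bimodule. -/

section DualizingConsequences

open CategoryTheory

variable {Λ ω : Type u} [Ring Λ] [AddCommGroup ω] [Module Λ ω] [Module Λᵐᵒᵖ ω]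
  [SMulCommClass Λ Λᵐᵒᵖ ω]

theorem IsDualizing.isFGFinInjDim (hω : IsDualizing Λ ω) : IsFGFinInjDim Λ ω :=
  (hω.tensor_mem Λ isFGFinProjDim_self).of_linearEquiv (tensorSelfEquiv Λ ω)

variable (ω) in
/-- The functor `Hom_Λ(ω, -)` on isomorphisms. -/
def homCongr {X Y : Type u} [AddCommGroup X] [Module Λ X] [AddCommGroup Y] [Module Λ Y]
    (e : X ≃ₗ[Λ] Y) : HomOver Λ ω X ≃ₗ[Λ] HomOver Λ ω Y :=
  LinearEquiv.ofLinearMap (homMap ω e.toLinearMap) (homMap ω e.symm.toLinearMap)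
    (LinearMap.ext fun _ => HomOver.ext fun _ => e.apply_symm_apply _)
    (LinearMap.ext fun _ => HomOver.ext fun _ => e.symm_apply_apply _)

/-- Since `ω ⊗ Λ` is `ω`, the unit of the adjunction at `Λ` identifies `Λ` with `Hom(ω, ω)`. -/
theorem IsDualizing.projective_homOver (hω : IsDualizing Λ ω) :
    Module.Projective Λ (HomOver Λ ω ω) :=
  Module.Projective.of_equiv (LinearEquiv.ofBijective _ (hω.unit_bijective Λ isFGFinProjDim_self) ≪≫ₗ
    homCongr ω (tensorSelfEquiv Λ ω))

theorem IsDualizing.projective_homOver_pi (hω : IsDualizing Λ ω) (m : ℕ) :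
    Module.Projective Λ (HomOver Λ ω (Fin m → ω)) := by
  have := hω.projective_homOver
  let φ : HomOver Λ ω (Fin m → ω) →ₗ[Λ] (Fin m → HomOver Λ ω ω) :=
    LinearMap.pi fun i => homMap ω (LinearMap.proj i)
  have hφ : Function.Bijective φ := by
    refine ⟨fun f g hfg => HomOver.ext fun w => funext fun i => ?_, fun f =>
      ⟨HomOver.of (LinearMap.pi fun i => (f i).toHom), rfl⟩⟩
    exact congrArg (fun t => HomOver.toHom t w) (congrFun hfg i)
  have : Module.Projective Λ (Fin m → HomOver Λ ω ω) :=
    Module.Projective.of_equiv (DFinsupp.linearEquivFunOnFintype (R := Λ))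
  exact Module.Projective.of_equiv (LinearEquiv.ofBijective φ hφ).symm

section

variable {A B C : Type u} [AddCommGroup A] [Module Λ A] [AddCommGroup B] [Module Λ B]
  [AddCommGroup C] [Module Λ C] {f : A →ₗ[Λ] B} {g : B →ₗ[Λ] C}

theorem homMap_injective (hf : Function.Injective f) : Function.Injective (homMap ω f) :=
  fun _ _ hab => HomOver.ext fun w => hf (congrArg (fun t => HomOver.toHom t w) hab)

theorem homMap_exact (hf : Function.Injective f) (hfg : Function.Exact f g) :
    Function.Exact (homMap ω f) (homMap ω g) := fun b => by
  constructor
  · intro hb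
    have hb' : ∀ w, b.toHom w ∈ LinearMap.range f := fun w =>
      (hfg _).1 (congrArg (fun t => HomOver.toHom t w) hb)
    refine ⟨HomOver.of ((LinearEquiv.ofInjective f hf).symm.toLinearMap ∘ₗ
      b.toHom.codRestrict (LinearMap.range f) hb'), HomOver.ext fun w => ?_⟩
    change f ((LinearEquiv.ofInjective f hf).symm ⟨b.toHom w, hb' w⟩) = b.toHom w
    exact congrArg Subtype.val ((LinearEquiv.ofInjective f hf).apply_symm_apply ⟨b.toHom w, hb' w⟩)
  · rintro ⟨a, rfl⟩
    exact HomOver.ext fun w => (hfg _).2 ⟨a.toHom w, rfl⟩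

/-- The functor `Hom_Λ(ω, -)` is exact on the modules of finite injective dimension. -/
theorem IsDualizing.homMap_surjective (hω : IsDualizing Λ ω) (hA : IsFGFinInjDim Λ A)
    (hB : IsFGFinInjDim Λ B) (hf : Function.Injective f) (hg : Function.Surjective g)
    (hfg : Function.Exact f g) : Function.Surjective (homMap ω g) := by
  set φ := homMap ω f
  have hφ : Function.Injective φ := homMap_injective hf
  -- The cokernel of `φ` has finite projective dimension, so its unit is bijective. Right exactness
  -- of the tensor product makes `adj j` an isomorphism onto `C`. As `j` is the unit followed by the
  -- map that `adj j` induces, it is surjective.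
  have hZ : IsFGFinProjDim Λ (HomOver Λ ω B ⧸ LinearMap.range φ) :=
    (hω.hom_mem A hA).right (hω.hom_mem B hB) hφ (Submodule.mkQ_surjective _)
      (LinearMap.exact_map_mkQ_range φ)
  let j : (HomOver Λ ω B ⧸ LinearMap.range φ) →ₗ[Λ] HomOver Λ ω C :=
    (LinearMap.range φ).liftQ (homMap ω g) (by
      rintro _ ⟨a, rfl⟩
      exact (homMap_exact hf hfg _).2 ⟨a, rfl⟩)
  have hcomp : adj j ∘ₗ tensorMap ω (LinearMap.range φ).mkQ = g ∘ₗ counit Λ ω B :=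
    tensorOver_hom_ext fun _ _ => rfl
  have hcompA : counit Λ ω B ∘ₗ tensorMap ω φ = f ∘ₗ counit Λ ω A :=
    counit_comp_tensorMap_homMap f
  have hzero : tensorMap ω (LinearMap.range φ).mkQ ∘ₗ tensorMap ω φ = 0 :=
    tensorOver_hom_ext fun w a => by
      change tmulOver Λ ω _ w ((LinearMap.range φ).mkQ (φ a)) = 0
      have : (LinearMap.range φ).mkQ (φ a) = 0 := (Submodule.Quotient.mk_eq_zero _).2 ⟨a, rfl⟩
      rw [this, tmulOver, TensorProduct.tmul_zero, map_zero]
  have hθ : Function.Bijective (adj j) := by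
    constructor
    · rw [injective_iff_map_eq_zero]
      intro ξ hξ
      obtain ⟨η, rfl⟩ := tensorMap_surjective _ (Submodule.mkQ_surjective (LinearMap.range φ)) ξ
      have h1 : g (counit Λ ω B η) = 0 := (LinearMap.congr_fun hcomp η).symm.trans hξ
      obtain ⟨a, ha⟩ := (hfg _).1 h1
      obtain ⟨η', rfl⟩ := (hω.counit_bijective A hA).2 a
      have h2 : η = tensorMap ω φ η' := (hω.counit_bijective B hB).1
        (ha.symm.trans (LinearMap.congr_fun hcompA η').symm)
      rw [h2]
      exact LinearMap.congr_fun hzero η'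
    · intro c
      obtain ⟨b, rfl⟩ := hg c
      obtain ⟨η, rfl⟩ := (hω.counit_bijective B hB).2 b
      exact ⟨tensorMap ω (LinearMap.range φ).mkQ η, LinearMap.congr_fun hcomp η⟩
  intro c
  obtain ⟨z, hz⟩ := (hω.unit_bijective _ hZ).2
    (homMap ω (LinearEquiv.ofBijective _ hθ).symm.toLinearMap c)
  have hjz : j z = c := HomOver.ext fun w => by
    have h1 : (j z).toHom w = adj j ((unit Λ ω _ z).toHom w) := rfl
    rw [h1, hz]
    exact (LinearEquiv.ofBijective _ hθ).apply_symm_apply _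
  obtain ⟨b, rfl⟩ := Submodule.mkQ_surjective _ z
  exact ⟨b, hjz⟩

end

/-- A module of finite injective dimension is covered by a finite power of `ω`, and the cover
remains surjective under `Hom_Λ(ω, -)`. -/
theorem IsDualizing.exists_cover (hω : IsDualizing Λ ω) (K : Type u) [AddCommGroup K] [Module Λ K]
    (hK : IsFGFinInjDim Λ K) : ∃ (m : ℕ) (φ : (Fin m → ω) →ₗ[Λ] K),
      Function.Surjective φ ∧ Function.Surjective (homMap ω φ) := by
  have := (hω.hom_mem K hK).1
  obtain ⟨m, s, hs⟩ := Module.Finite.exists_fin (R := Λ) (M := HomOver Λ ω K)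
  let φ : (Fin m → ω) →ₗ[Λ] K := ∑ i, (s i).toHom ∘ₗ LinearMap.proj i
  have hφ : Function.Surjective (homMap ω φ) := by
    rw [← LinearMap.range_eq_top, eq_top_iff, ← hs, Submodule.span_le]
    rintro _ ⟨i, rfl⟩
    refine ⟨HomOver.of (LinearMap.single Λ (fun _ => ω) i), HomOver.ext fun w => ?_⟩
    change φ (Pi.single i w) = (s i).toHom w
    simp only [φ, LinearMap.sum_apply, LinearMap.comp_apply, LinearMap.proj_apply]
    rw [Finset.sum_eq_single i]
    · rw [Pi.single_eq_same]
    · intro j _ hj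
      rw [Pi.single_eq_of_ne hj, map_zero]
    · simp
  refine ⟨m, φ, ?_, hφ⟩
  -- By surjectivity of the counit, `K` is generated by the images of homomorphisms from `ω`, all of
  -- which factor through `φ`.
  rw [← LinearMap.range_eq_top, eq_top_iff]
  intro k _
  obtain ⟨t, rfl⟩ := (hω.counit_bijective K hK).2 k
  refine tensorOver_induction (p := fun t => counit Λ ω K t ∈ LinearMap.range φ) ?_ (fun w f => ?_)
    (fun a b ha hb => ?_) t
  · rw [map_zero]; exact Submodule.zero_mem _
  · obtain ⟨v, rfl⟩ := hφ f
    exact ⟨v.toHom w, rfl⟩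
  · rw [map_add]; exact Submodule.add_mem _ ha hb

section ArtinAlgebra

variable [IsArtinAlgebra Λ]

theorem exists_shortExact_injective (A : Type u) [AddCommGroup A] [Module Λ A]
    [Module.Finite Λ A] : ∃ (I : ModuleCat.{u} Λ) (i : A →ₗ[Λ] I), Module.Finite Λ I ∧
      Module.Injective Λ I ∧ Function.Injective i := by
  obtain ⟨R, _, _, _, _⟩ := IsArtinAlgebra.out (Λ := Λ)
  exact exists_embedding_injective R A

/-- Shift along an embedding into a finitely generated injective module, whose cokernel again has
finite injective dimension. In degree one the vanishing is the exactness of `Hom(ω, -)`. -/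
theorem IsDualizing.ext_eq_zero (hω : IsDualizing Λ ω) (k : ℕ) (A : Type u) [AddCommGroup A]
    [Module Λ A] (hA : IsFGFinInjDim Λ A)
    (e : Abelian.Ext (ModuleCat.of Λ ω) (ModuleCat.of Λ A) (k + 1)) : e = 0 := by
  induction k generalizing A with
  | zero =>
    have := hA.1
    obtain ⟨I, i, _, hI, hi⟩ := exists_shortExact_injective (Λ := Λ) A
    refine ExtVanish.codomain_left_one hI hi (Submodule.mkQ_surjective _)
      (LinearMap.exact_map_mkQ_range i) (fun c => ?_) e
    obtain ⟨b, hb⟩ := hω.homMap_surjective hA (isFGFinInjDim_of_injective hI) hi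
      (Submodule.mkQ_surjective _) (LinearMap.exact_map_mkQ_range i) (HomOver.of c)
    exact ⟨b.toHom, hb⟩
  | succ k ih =>
    have := hA.1
    obtain ⟨I, i, _, hI, hi⟩ := exists_shortExact_injective (Λ := Λ) A
    exact ExtVanish.codomain_left_succ hI k
      (ih _ (hA.right (isFGFinInjDim_of_injective hI) hi (Submodule.mkQ_surjective _)
        (LinearMap.exact_map_mkQ_range i))) hi (Submodule.mkQ_surjective _)
      (LinearMap.exact_map_mkQ_range i) e

theorem IsDualizing.extVanish_self (hω : IsDualizing Λ ω) : ExtVanish Λ ω ω 0 := fun i hi e => by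
  obtain ⟨i, rfl⟩ := Nat.exists_eq_succ_of_ne_zero hi.ne'
  exact hω.ext_eq_zero i ω hω.isFGFinInjDim e

/-- Covers by powers of `ω` correspond under `Hom(ω, -)` to covers by projectives, so `K` has a
finite resolution by summands of powers of `ω`; the induction is on the projective dimension of
`Hom(ω, K)`. -/
theorem IsDualizing.extVanish_of_isFGFinInjDim (hω : IsDualizing Λ ω) {Y : Type u} [AddCommGroup Y]
    [Module Λ Y] (hY : ExtVanish Λ Y ω 0) {K : Type u} [AddCommGroup K] [Module Λ K]
    (hK : IsFGFinInjDim Λ K) : ExtVanish Λ Y K 0 := by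
  obtain ⟨n, hn⟩ := (hω.hom_mem K hK).2
  replace hn : HasProjectiveDimensionLT (ModuleCat.of Λ (HomOver Λ ω K)) (n + 1) := hn
  induction n generalizing K with
  | zero =>
    obtain ⟨m, φ, hφ, hFφ⟩ := hω.exists_cover K hK
    have hproj : Projective (ModuleCat.of Λ (HomOver Λ ω K)) :=
      projective_iff_hasProjectiveDimensionLT_one.2 hn
    have := (IsProjective.iff_projective (R := Λ) (HomOver Λ ω K)).2 hproj
    -- The adjoint of the section `s`, preceded by the inverse of the counit, splits `φ`.
    obtain ⟨s, hs⟩ := Module.projective_lifting_property (homMap ω φ) LinearMap.id hFφ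
    let e := LinearEquiv.ofBijective _ (hω.counit_bijective K hK)
    refine (hY.codomain_pi m).retract_right (adj s ∘ₗ e.symm.toLinearMap) φ
      (LinearMap.ext fun k => ?_)
    obtain ⟨t, rfl⟩ := e.surjective k
    change φ (adj s (e.symm (e t))) = e t
    rw [e.symm_apply_apply]
    have : φ ∘ₗ adj s = counit Λ ω K := tensorOver_hom_ext fun w f => by
      change (homMap ω φ (s f)).toHom w = f.toHom w
      exact congrArg (fun t => HomOver.toHom t w) (LinearMap.congr_fun hs f)
    exact LinearMap.congr_fun this t
  | succ n ih =>
    obtain ⟨m, φ, hφ, hFφ⟩ := hω.exists_cover K hK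
    have hinj := Submodule.subtype_injective (LinearMap.ker φ)
    have hex := LinearMap.exact_subtype_ker_map φ
    have hA : IsFGFinInjDim Λ (LinearMap.ker φ) := (hω.isFGFinInjDim.pi m).left hK hinj hφ hex
    have := hω.projective_homOver_pi m
    have hproj := (IsProjective.iff_projective (R := Λ) (HomOver Λ ω (Fin m → ω))).1 this
    have hlt : HasProjectiveDimensionLT (ModuleCat.of Λ (HomOver Λ ω (Fin m → ω))) (n + 1) :=
      hasProjectiveDimensionLT_of_ge _ 1 (n + 1) (by omega)
    have h1 := (shortExact_of_exact _ _ (homMap_injective hinj) hFφ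
      (homMap_exact hinj hex)).hasProjectiveDimensionLT_X₁ (n + 1) hlt hn
    exact (ih hA h1).codomain_right (hY.codomain_pi m) hinj hφ hex

end ArtinAlgebra

end DualizingConsequences

/-! ### The class `Add ω` and its coresolutions. -/

section Add

variable {Λ ω : Type u} [Ring Λ] [AddCommGroup ω] [Module Λ ω]

theorem isInAdd_pi (m : ℕ) : IsInAdd Λ ω (Fin m → ω) := by
  let e : (Fin m → ω) ≃ₗ[Λ] (ULift.{u} (Fin m) →₀ ω) :=
    LinearEquiv.funCongrLeft Λ ω Equiv.ulift ≪≫ₗ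
      (Finsupp.linearEquivFunOnFinite Λ ω (ULift.{u} (Fin m))).symm
  exact ⟨ULift.{u} (Fin m), e.toLinearMap, e.symm.toLinearMap, LinearMap.ext e.symm_apply_apply⟩

/-- A homomorphism from a finitely generated module into a member of `Add ω` factors through a
finite power of `ω`. -/
theorem IsInAdd.exists_factor {W X : Type u} [AddCommGroup W] [Module Λ W] (hW : IsInAdd Λ ω W)
    [AddCommGroup X] [Module Λ X] [Module.Finite Λ X] (f : X →ₗ[Λ] W) :
    ∃ (m : ℕ) (a : X →ₗ[Λ] (Fin m → ω)) (b : (Fin m → ω) →ₗ[Λ] W), b ∘ₗ a = f := by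
  classical
  obtain ⟨I, i, p, hpi⟩ := hW
  obtain ⟨r, s, hs⟩ := Module.Finite.exists_fin (R := Λ) (M := X)
  let S : Finset I := Finset.univ.biUnion fun j => (i (f (s j))).support
  have hsupp : ∀ x, i (f x) ∈ Finsupp.supported ω Λ (S : Set I) := by
    have : Submodule.span Λ (Set.range s) ≤ (Finsupp.supported ω Λ (S : Set I)).comap (i ∘ₗ f) := by
      rw [Submodule.span_le]
      rintro _ ⟨j, rfl⟩
      change i (f (s j)) ∈ Finsupp.supported ω Λ (S : Set I)
      rw [Finsupp.mem_supported]
      exact_mod_cast Finset.subset_biUnion_of_mem (fun j => (i (f (s j))).support)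
        (Finset.mem_univ j)
    intro x
    exact this (hs ▸ Submodule.mem_top)
  let e := S.equivFin
  refine ⟨S.card, LinearMap.pi fun k => Finsupp.lapply (e.symm k : I) ∘ₗ i ∘ₗ f,
    p ∘ₗ ∑ k, Finsupp.lsingle (e.symm k : I) ∘ₗ LinearMap.proj k, LinearMap.ext fun x => ?_⟩
  have h1 : ∑ k, Finsupp.single (e.symm k : I) (i (f x) (e.symm k : I)) = i (f x) := by
    rw [Equiv.sum_comp e.symm fun t : S => Finsupp.single (t : I) (i (f x) (t : I)),
      Finset.sum_coe_sort S fun t => Finsupp.single t (i (f x) t)]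
    refine (Finset.sum_subset ?_ fun t _ ht => ?_).symm.trans (Finsupp.sum_single (i (f x)))
    · exact_mod_cast (Finsupp.mem_supported _ _).1 (hsupp x)
    · rw [Finsupp.notMem_support_iff.1 ht, Finsupp.single_zero]
  have h2 : p (i (f x)) = f x := LinearMap.congr_fun hpi (f x)
  simp only [LinearMap.comp_apply, LinearMap.sum_apply, LinearMap.proj_apply, LinearMap.pi_apply,
    Finsupp.lapply_apply, Finsupp.lsingle_apply]
  rw [h1, h2]

theorem IsGorensteinProjective.exists_shortExact {M : Type u} [AddCommGroup M] [Module Λ M]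
    (hM : IsGorensteinProjective Λ ω M) : ∃ (W N : ModuleCat.{u} Λ) (i : M →ₗ[Λ] W)
      (q : W →ₗ[Λ] N), IsInAdd Λ ω W ∧ IsGorensteinProjective Λ ω N ∧ Function.Injective i ∧
      Function.Surjective q ∧ Function.Exact i q := by
  obtain ⟨w, ε, d, hw, hε, hεd, hd⟩ := hM
  refine ⟨w 0, ModuleCat.of Λ (LinearMap.range (d 0)), ε, (d 0).rangeRestrict, hw 0,
    ⟨fun n => w (n + 1), (LinearMap.range (d 0)).subtype, fun n => d (n + 1), fun n => hw (n + 1),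
      Submodule.subtype_injective _, fun y => ?_, fun n => hd (n + 1)⟩, hε,
    (d 0).surjective_rangeRestrict, fun x => ?_⟩
  · rw [hd 0 y]
    exact ⟨fun ⟨x, hx⟩ => ⟨⟨d 0 x, x, rfl⟩, hx⟩, fun ⟨x, hx⟩ => hx ▸ x.2⟩
  · rw [← hεd x]
    exact Subtype.ext_iff

end Add

/-! ### CM modules as the finitely generated modules without extensions by `ω`. -/

section CohenMacaulay

open CategoryTheory

variable {Λ ω : Type u} [Ring Λ] [AddCommGroup ω] [Module Λ ω] [Module Λᵐᵒᵖ ω]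
  [SMulCommClass Λ Λᵐᵒᵖ ω] [IsArtinAlgebra Λ]

/-- A finitely generated module without extensions by `ω` has an injective left `add ω`
approximation. -/
theorem IsDualizing.exists_left_approximation (hω : IsDualizing Λ ω) (Y : Type u) [AddCommGroup Y]
    [Module Λ Y] [Module.Finite Λ Y] (hY : ExtVanish Λ Y ω 0) :
    ∃ (m : ℕ) (φ : Y →ₗ[Λ] (Fin m → ω)), Function.Injective φ ∧
      ∀ f : Y →ₗ[Λ] ω, ∃ g : (Fin m → ω) →ₗ[Λ] ω, g ∘ₗ φ = f := by
  have := hω.finite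
  obtain ⟨m, φ, hφ⟩ : ∃ (m : ℕ) (φ : Y →ₗ[Λ] (Fin m → ω)), ∀ f : Y →ₗ[Λ] ω,
      ∃ g : (Fin m → ω) →ₗ[Λ] ω, g ∘ₗ φ = f := by
    obtain ⟨R, _, _, _, _⟩ := IsArtinAlgebra.out (Λ := Λ)
    exact CMArtin.exists_left_approximation R Y ω
  refine ⟨m, φ, ?_, hφ⟩
  -- The kernel of an `ω`-cover of `I` has finite injective dimension, so `Y` has no extensions by
  -- it and the embedding `i` lifts to an injection into a power of `ω`. Its components factor
  -- through `φ`.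
  obtain ⟨I, i, _, hI, hi⟩ := exists_shortExact_injective (Λ := Λ) Y
  have hI' := isFGFinInjDim_of_injective hI
  obtain ⟨k, ψ, hψ, -⟩ := hω.exists_cover I hI'
  have hinj := Submodule.subtype_injective (LinearMap.ker ψ)
  have hex := LinearMap.exact_subtype_ker_map ψ
  have hK := (hω.isFGFinInjDim.pi k).left hI' hinj hψ hex
  obtain ⟨l, hl⟩ := (hω.extVanish_of_isFGFinInjDim hY hK).exists_lift hinj hψ hex i
  rw [injective_iff_map_eq_zero]
  intro y hy
  have hly : l y = 0 := funext fun j => by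
    obtain ⟨g, hg⟩ := hφ (LinearMap.proj j ∘ₗ l)
    have := LinearMap.congr_fun hg y
    rw [LinearMap.comp_apply, hy, map_zero] at this
    exact this.symm
  have h1 : ψ (l y) = i y := LinearMap.congr_fun hl y
  rw [hly, map_zero] at h1
  exact hi (by rw [← h1, map_zero])

/-- Finitely generated modules without extensions by `ω` are `ω`-Gorenstein projective. -/
theorem IsDualizing.isGorensteinProjective (hω : IsDualizing Λ ω) (Y : Type u) [AddCommGroup Y]
    [Module Λ Y] [Module.Finite Λ Y] (hY : ExtVanish Λ Y ω 0) : IsGorensteinProjective Λ ω Y := by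
  have := hω.finite
  let S := {Y : ModuleCat.{u} Λ // Module.Finite Λ Y ∧ ExtVanish Λ Y ω 0}
  have H : ∀ Y : S, ∃ (m : ℕ) (φ : Y.1 →ₗ[Λ] (Fin m → ω)), Function.Injective φ ∧
      ∀ f : Y.1 →ₗ[Λ] ω, ∃ g : (Fin m → ω) →ₗ[Λ] ω, g ∘ₗ φ = f := fun Y =>
    have := Y.2.1
    hω.exists_left_approximation Y.1 Y.2.2
  choose m φ hφ hφ' using H
  -- The cokernel stays in `S` because every map to `ω` extends along the approximation. Iteration
  -- yields the coresolution.
  let next : S → S := fun Y => ⟨ModuleCat.of Λ ((Fin (m Y) → ω) ⧸ LinearMap.range (φ Y)),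
    inferInstanceAs (Module.Finite Λ ((Fin (m Y) → ω) ⧸ LinearMap.range (φ Y))),
    Y.2.2.right (hω.extVanish_self.pi (m Y)) (hφ Y) (Submodule.mkQ_surjective _)
      (LinearMap.exact_map_mkQ_range (φ Y)) (hφ' Y)⟩
  let s₀ : S := ⟨ModuleCat.of Λ Y, inferInstanceAs (Module.Finite Λ Y), hY⟩
  let s : ℕ → S := fun n => Nat.rec (motive := fun _ => S) s₀ (fun _ Y => next Y) n
  have hs : ∀ n, Function.Exact (φ (s n))
      (φ (s (n + 1)) ∘ₗ (LinearMap.range (φ (s n))).mkQ) := fun n x => by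
    rw [← LinearMap.exact_map_mkQ_range (φ (s n)) x]
    exact ⟨fun h => hφ (s (n + 1)) (h.trans (map_zero _).symm), fun h => by
      rw [LinearMap.comp_apply, h, map_zero]⟩
  refine ⟨fun n => ModuleCat.of Λ (Fin (m (s n)) → ω), φ (s 0),
    fun n => φ (s (n + 1)) ∘ₗ (LinearMap.range (φ (s n))).mkQ, fun n => isInAdd_pi _, hφ (s 0),
    hs 0, fun n x => ?_⟩
  refine (hs (n + 1) x).trans ?_
  constructor
  · rintro ⟨y, hy⟩
    obtain ⟨v, rfl⟩ := Submodule.mkQ_surjective _ y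
    exact ⟨v, hy⟩
  · rintro ⟨y, hy⟩
    exact ⟨_, hy⟩

/-- A homomorphism from a finitely generated module to an `ω`-Gorenstein projective module factors
through a finitely generated module whose extensions by `ω` vanish above degree `k`. -/
theorem IsDualizing.exists_factor_aux (hω : IsDualizing Λ ω) {n : ℕ}
    (hn : HasInjectiveDimensionLE (ModuleCat.of Λ ω) n) (j k : ℕ) (hjk : n ≤ j + k)
    (M X : Type u) [AddCommGroup M] [Module Λ M] (hM : IsGorensteinProjective Λ ω M)
    [AddCommGroup X] [Module Λ X] [Module.Finite Λ X] (f : X →ₗ[Λ] M) :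
    ∃ (Y : ModuleCat.{u} Λ) (a : X →ₗ[Λ] Y) (b : Y →ₗ[Λ] M), Module.Finite Λ Y ∧
      ExtVanish Λ Y ω k ∧ b ∘ₗ a = f := by
  have := hω.finite
  -- Here `j` counts the steps still to be taken along the coresolution of `M`. Each step relaxes
  -- the required vanishing by one degree, until `n ≤ k` and `X` itself will do.
  induction j generalizing k M X with
  | zero =>
    exact ⟨ModuleCat.of Λ X, LinearMap.id, f, ‹_›,
      (extVanish_of_injectiveDimension hn).mono (by omega), rfl⟩
  | succ j ih =>
    obtain ⟨W, N, i, q, hW, hN, hi, hq, hiq⟩ := hM.exists_shortExact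
    obtain ⟨m, u, v, huv⟩ := hW.exists_factor (i ∘ₗ f)
    have huv' : ∀ x, v (u x) = i (f x) := LinearMap.congr_fun huv
    have hle : LinearMap.range u ≤ LinearMap.ker (q ∘ₗ v) := by
      rintro _ ⟨x, rfl⟩
      change q (v (u x)) = 0
      rw [huv']
      exact (hiq _).2 ⟨f x, rfl⟩
    obtain ⟨Y', a', b', _, hY', hab⟩ := ih (k + 1) (by omega) N ((Fin m → ω) ⧸ LinearMap.range u) hN
      ((LinearMap.range u).liftQ (q ∘ₗ v) hle)
    -- A free summand makes `τ` onto, so that its kernel gains one degree of vanishing over `Y'`.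
    -- The lift `σ` extends `v` to a map `ρ` into `W`, which sends this kernel into `M = ker q`.
    obtain ⟨r, π, hπ⟩ := Module.Finite.exists_fin' Λ Y'
    obtain ⟨σ, hσ⟩ := Module.projective_lifting_property q (b' ∘ₗ π) hq
    let τ : (Fin m → ω) × (Fin r → Λ) →ₗ[Λ] Y' := (a' ∘ₗ (LinearMap.range u).mkQ).coprod π
    have hτ : Function.Surjective τ := fun y => by
      obtain ⟨p, rfl⟩ := hπ y
      exact ⟨(0, p), by simp [τ]⟩
    let ρ : (Fin m → ω) × (Fin r → Λ) →ₗ[Λ] W := v.coprod σ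
    have hρ : ∀ x, q (ρ x) = b' (τ x) := fun x => by
      have h1 : b' (a' ((LinearMap.range u).mkQ x.1)) = q (v x.1) :=
        LinearMap.congr_fun hab ((LinearMap.range u).mkQ x.1)
      have h2 : q (σ x.2) = b' (π x.2) := LinearMap.congr_fun hσ x.2
      change q (v x.1 + σ x.2) = b' (a' ((LinearMap.range u).mkQ x.1) + π x.2)
      rw [map_add, map_add, h1, h2]
    have hmem : ∀ x : LinearMap.ker τ, ρ x ∈ LinearMap.range i := fun x => (hiq _).1 <| by
      rw [hρ, show τ x = 0 from x.2, map_zero]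
    refine ⟨ModuleCat.of Λ (LinearMap.ker τ), (u.prod 0).codRestrict _ fun x => ?_,
      (LinearEquiv.ofInjective i hi).symm.toLinearMap ∘ₗ
        (ρ ∘ₗ (LinearMap.ker τ).subtype).codRestrict _ hmem,
      inferInstanceAs (Module.Finite Λ (LinearMap.ker τ)), ?_, LinearMap.ext fun x => hi ?_⟩
    · change a' ((LinearMap.range u).mkQ (u x)) + π 0 = 0
      have : (LinearMap.range u).mkQ (u x) = 0 := (Submodule.Quotient.mk_eq_zero _).2 ⟨x, rfl⟩
      rw [this, map_zero, map_zero, add_zero]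
    · exact ExtVanish.left ((hω.extVanish_self.pi m).prod extVanish_of_projective) hY'
        (Submodule.subtype_injective _) hτ (LinearMap.exact_subtype_ker_map τ)
    · rw [← huv']
      refine (congrArg Subtype.val ((LinearEquiv.ofInjective i hi).apply_symm_apply _)).trans ?_
      change v (u x) + σ 0 = v (u x)
      rw [map_zero, add_zero]

/-- A homomorphism from a finitely generated module to an `ω`-Gorenstein projective module factors
through a finitely generated module without extensions by `ω`. -/
theorem IsDualizing.exists_factor (hω : IsDualizing Λ ω) (M X : Type u) [AddCommGroup M]
    [Module Λ M] (hM : IsGorensteinProjective Λ ω M) [AddCommGroup X] [Module Λ X]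
    [Module.Finite Λ X] (f : X →ₗ[Λ] M) :
    ∃ (Y : ModuleCat.{u} Λ) (a : X →ₗ[Λ] Y) (b : Y →ₗ[Λ] M), Module.Finite Λ Y ∧
      ExtVanish Λ Y ω 0 ∧ b ∘ₗ a = f := by
  obtain ⟨n, hn⟩ := hω.isFGFinInjDim.2
  exact hω.exists_factor_aux hn n 0 le_rfl M X hM f

/-- Factoring the identity shows `X` to be a retract of a module without extensions by `ω`. -/
theorem IsDualizing.extVanish (hω : IsDualizing Λ ω) (X : Type u) [AddCommGroup X] [Module Λ X]
    [Module.Finite Λ X] (hX : IsGorensteinProjective Λ ω X) : ExtVanish Λ X ω 0 := by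
  obtain ⟨Y, a, b, _, hY, hab⟩ := hω.exists_factor X X hX LinearMap.id
  exact hY.retract_left a b hab

/-- Auslander–Buchweitz approximation. A syzygy of `E` is approximated by `π' : Y' → ker p`; then
`Y` is the cokernel of `Y'` in `ω ^ m × Λ ^ r`, with `Y' → ω ^ m` a left approximation. The kernel
of `Y → E` is `ω ^ m` modulo the image of `ker π'`, hence of finite injective dimension. -/
theorem IsDualizing.exists_right_approximation_aux (hω : IsDualizing Λ ω) (k : ℕ) (E : Type u)
    [AddCommGroup E] [Module Λ E] [Module.Finite Λ E] (hE : ExtVanish Λ E ω k) :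
    ∃ (Y : ModuleCat.{u} Λ) (π : Y →ₗ[Λ] E), Module.Finite Λ Y ∧ ExtVanish Λ Y ω 0 ∧
      Function.Surjective π ∧ IsFGFinInjDim Λ (LinearMap.ker π) := by
  have := hω.finite
  induction k generalizing E with
  | zero =>
    refine ⟨ModuleCat.of Λ E, LinearMap.id, ‹_›, hE, Function.surjective_id, ?_⟩
    have : Subsingleton (LinearMap.ker (LinearMap.id : E →ₗ[Λ] E)) := by
      rw [LinearMap.ker_id]; infer_instance
    exact isFGFinInjDim_of_injective injective_of_subsingleton
  | succ k ih =>
    obtain ⟨r, p, hp⟩ := Module.Finite.exists_fin' Λ E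
    obtain ⟨Y', π', _, hY', hπ', hK'⟩ := ih (LinearMap.ker p)
      (ExtVanish.left extVanish_of_projective hE (Submodule.subtype_injective _) hp
        (LinearMap.exact_subtype_ker_map p))
    obtain ⟨m, φ, hφ, hφ'⟩ := hω.exists_left_approximation Y' hY'
    let j : Y' →ₗ[Λ] (Fin m → ω) × (Fin r → Λ) := φ.prod ((LinearMap.ker p).subtype ∘ₗ π')
    have hj : Function.Injective j := fun x y hxy => hφ (congrArg Prod.fst hxy)
    let π : (((Fin m → ω) × (Fin r → Λ)) ⧸ LinearMap.range j) →ₗ[Λ] E :=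
      (LinearMap.range j).liftQ (p ∘ₗ LinearMap.snd Λ _ _) (by
        rintro _ ⟨y, rfl⟩
        exact (π' y).2)
    have hπ : Function.Surjective π := fun e => by
      obtain ⟨x, rfl⟩ := hp e
      exact ⟨(LinearMap.range j).mkQ (0, x), rfl⟩
    refine ⟨ModuleCat.of Λ (((Fin m → ω) × (Fin r → Λ)) ⧸ LinearMap.range j), π,
      inferInstanceAs (Module.Finite Λ (((Fin m → ω) × (Fin r → Λ)) ⧸ LinearMap.range j)), ?_, hπ,
      ?_⟩
    · refine hY'.right ((hω.extVanish_self.pi m).prod extVanish_of_projective) hj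
        (Submodule.mkQ_surjective _) (LinearMap.exact_map_mkQ_range j) fun a => ?_
      obtain ⟨b, rfl⟩ := hφ' a
      exact ⟨b ∘ₗ LinearMap.fst Λ _ _, rfl⟩
    · let κ : (Fin m → ω) →ₗ[Λ] LinearMap.ker π :=
        ((LinearMap.range j).mkQ ∘ₗ LinearMap.inl Λ _ _).codRestrict _ fun v => map_zero p
      have hκ : Function.Surjective κ := by
        rintro ⟨z, hz⟩
        obtain ⟨⟨v, x⟩, rfl⟩ := Submodule.mkQ_surjective _ z
        obtain ⟨y, hy⟩ := hπ' ⟨x, hz⟩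
        refine ⟨v - φ y, Subtype.ext ((Submodule.Quotient.eq _).2 ⟨-y, ?_⟩)⟩
        have hy' : (π' y : Fin r → Λ) = x := congrArg Subtype.val hy
        refine Prod.ext ?_ ?_
        · change φ (-y) = v - φ y - v
          rw [map_neg]; abel
        · change ((π' (-y) : LinearMap.ker p) : Fin r → Λ) = 0 - x
          rw [map_neg, zero_sub, ← hy']; rfl
      refine hK'.right (f := φ ∘ₗ (LinearMap.ker π').subtype) (g := κ) (hω.isFGFinInjDim.pi m)
        (hφ.comp (Submodule.subtype_injective _)) hκ fun v => ⟨fun hv => ?_, ?_⟩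
      · obtain ⟨y, hy⟩ := (Submodule.Quotient.mk_eq_zero _).1 (congrArg Subtype.val hv)
        exact ⟨⟨y, Subtype.ext (congrArg Prod.snd hy)⟩, congrArg Prod.fst hy⟩
      · rintro ⟨y, rfl⟩
        refine Subtype.ext ((Submodule.Quotient.mk_eq_zero _).2 ⟨y, Prod.ext rfl ?_⟩)
        exact congrArg Subtype.val (show π' y = 0 from y.2)

/-- Every finitely generated module has a right approximation by a finitely generated module
without extensions by `ω`. -/
theorem IsDualizing.exists_right_approximation (hω : IsDualizing Λ ω) (E : Type u)
    [AddCommGroup E] [Module Λ E] [Module.Finite Λ E] :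
    ∃ (Y : ModuleCat.{u} Λ) (π : Y →ₗ[Λ] E), Module.Finite Λ Y ∧ ExtVanish Λ Y ω 0 ∧
      ∀ (X : Type u) [AddCommGroup X] [Module Λ X], ExtVanish Λ X ω 0 → ∀ f : X →ₗ[Λ] E,
        ∃ g : X →ₗ[Λ] Y, π ∘ₗ g = f := by
  obtain ⟨n, hn⟩ := hω.isFGFinInjDim.2
  obtain ⟨Y, π, hY, hY', hπ, hK⟩ :=
    hω.exists_right_approximation_aux n E (extVanish_of_injectiveDimension hn)
  exact ⟨Y, π, hY, hY', fun X _ _ hX f => (hω.extVanish_of_isFGFinInjDim hX hK).exists_lift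
    (Submodule.subtype_injective _) hπ (LinearMap.exact_subtype_ker_map π) f⟩

/-- A finitely generated module without extensions by `ω` is a finite direct sum of indecomposable
Cohen-Macaulay modules. -/
theorem IsDualizing.exists_decomposition (hω : IsDualizing Λ ω) (X : Type u) [AddCommGroup X]
    [Module Λ X] [Module.Finite Λ X] (hX : ExtVanish Λ X ω 0) :
    ∃ (n : ℕ) (C : Fin n → ModuleCat.{u} Λ), (∀ j, IsIndecomposableCM Λ ω (C j)) ∧
      Nonempty (X ≃ₗ[Λ] ∀ j, C j) := by
  obtain ⟨n, C, hC, ⟨e⟩⟩ := CMArtin.exists_decomposition (Λ := Λ) X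
  refine ⟨n, C, fun j => ?_, ⟨e⟩⟩
  have := (hC j).1
  exact ⟨(hC j).1, hω.isGorensteinProjective _ ((hX.of_linearEquiv e).retract_left
    (LinearMap.single Λ (fun j => C j) j) (LinearMap.proj j) (LinearMap.proj_comp_single_same ..)),
    (hC j).2⟩

/-- Among the indecomposable Cohen-Macaulay modules there are finite right almost split families. -/
theorem IsDualizing.exists_right_almost_split (hω : IsDualizing Λ ω) (Z : Type u) [AddCommGroup Z]
    [Module Λ Z] (hZ : IsIndecomposableCM Λ ω Z) :
    ∃ (n : ℕ) (Y : Fin n → ModuleCat.{u} Λ) (p : ∀ i, Y i →ₗ[Λ] Z),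
      (∀ i, IsIndecomposableCM Λ ω (Y i) ∧ ¬ Function.Bijective (p i)) ∧
      ∀ (X : Type u) [AddCommGroup X] [Module Λ X], IsIndecomposableCM Λ ω X →
        ∀ g : X →ₗ[Λ] Z, ¬ Function.Bijective g →
          ∃ h : ∀ i, X →ₗ[Λ] Y i, g = ∑ i, p i ∘ₗ h i := by
  have := hZ.finite
  have := hZ.indecomposable.1
  obtain ⟨B, π, _, hsplit, hfac⟩ : ∃ (B : ModuleCat.{u} Λ) (p : B →ₗ[Λ] Z), Module.Finite Λ B ∧
      (¬ ∃ s : Z →ₗ[Λ] B, p ∘ₗ s = LinearMap.id) ∧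
      ∀ (W : Type u) [AddCommGroup W] [Module Λ W] (g : W →ₗ[Λ] Z),
        (¬ ∃ s : Z →ₗ[Λ] W, g ∘ₗ s = LinearMap.id) → ∃ g' : W →ₗ[Λ] B, p ∘ₗ g' = g := by
    obtain ⟨R, _, _, _, _⟩ := IsArtinAlgebra.out (Λ := Λ)
    exact CMArtin.exists_right_almost_split R Z hZ.indecomposable
  -- Maps from CM modules to `B` factor through `ρ`, so the restrictions of `π ∘ₗ ρ` to the
  -- indecomposable summands of `E` form the family. A bijective restriction would split `π`.
  obtain ⟨E, ρ, _, hE, hρ⟩ := hω.exists_right_approximation B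
  obtain ⟨n, Y, hY, ⟨e⟩⟩ := hω.exists_decomposition E hE
  let p : ∀ i, Y i →ₗ[Λ] Z := fun i =>
    π ∘ₗ ρ ∘ₗ e.symm.toLinearMap ∘ₗ LinearMap.single Λ (fun i => Y i) i
  refine ⟨n, Y, p, fun i => ⟨hY i, fun hb => hsplit ?_⟩, fun X _ _ hX g hg => ?_⟩
  · exact ⟨(ρ ∘ₗ e.symm.toLinearMap ∘ₗ LinearMap.single Λ (fun i => Y i) i) ∘ₗ
      (LinearEquiv.ofBijective _ hb).symm.toLinearMap,
      LinearMap.ext fun z => (LinearEquiv.ofBijective _ hb).apply_symm_apply z⟩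
  · have := hX.finite
    obtain ⟨g', hg'⟩ := hfac X g fun ⟨s, hs⟩ =>
      hg (hX.indecomposable.bijective_of_comp_bijective s g (by
        rw [hs]; exact Function.bijective_id)).2
    obtain ⟨g'', hg''⟩ := hρ X (hω.extVanish X hX.gorensteinProjective) g'
    refine ⟨fun i => LinearMap.proj i ∘ₗ e.toLinearMap ∘ₗ g'', LinearMap.ext fun x => ?_⟩
    have h1 : ∑ i, Pi.single i (e (g'' x) i) = e (g'' x) := Finset.univ_sum_single _
    have h2 : g x = π (ρ (g'' x)) := by
      rw [← hg', ← hg'']; rfl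
    rw [h2, ← e.symm_apply_apply (g'' x), ← h1, map_sum, map_sum, map_sum, LinearMap.sum_apply]
    refine Finset.sum_congr rfl fun i _ => ?_
    simp [p]

end CohenMacaulay

/-! ### Powers of the radical. -/

section RadicalPowers

variable {Λ : Type u} [Ring Λ]

/-- The homomorphisms `W → Y` in the `k`-th power of the radical of the modules satisfying `P`. -/
def radPow (P : ModuleCat.{u} Λ → Prop) (Y : Type u) [AddCommGroup Y] [Module Λ Y] :
    ℕ → ∀ W : ModuleCat.{u} Λ, AddSubgroup (W →ₗ[Λ] Y)
  | 0, _ => ⊤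
  | k + 1, W => AddSubgroup.closure {g | ∃ (Z : ModuleCat.{u} Λ) (r : W →ₗ[Λ] Z) (u : Z →ₗ[Λ] Y),
      P Z ∧ ¬ Function.Bijective r ∧ u ∈ radPow P Y k Z ∧ u ∘ₗ r = g}

variable {P : ModuleCat.{u} Λ → Prop} {Y : Type u} [AddCommGroup Y] [Module Λ Y]

theorem comp_mem_radPow_succ {k : ℕ} {W Z : ModuleCat.{u} Λ} (hZ : P Z) (r : W →ₗ[Λ] Z)
    (hr : ¬ Function.Bijective r) {u : Z →ₗ[Λ] Y} (hu : u ∈ radPow P Y k Z) :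
    u ∘ₗ r ∈ radPow P Y (k + 1) W :=
  AddSubgroup.subset_closure ⟨Z, r, u, hZ, hr, hu, rfl⟩

theorem comp_mem_radPow_one {W Z : ModuleCat.{u} Λ} (hZ : P Z) (r : W →ₗ[Λ] Z)
    (hr : ¬ Function.Bijective r) (u : Z →ₗ[Λ] Y) : u ∘ₗ r ∈ radPow P Y 1 W :=
  comp_mem_radPow_succ hZ r hr (AddSubgroup.mem_top u)

theorem radPow_one_comp_equiv {W W' : ModuleCat.{u} Λ} {g : W →ₗ[Λ] Y} (hg : g ∈ radPow P Y 1 W)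
    (e : W' ≃ₗ[Λ] W) : g ∘ₗ e.toLinearMap ∈ radPow P Y 1 W' := by
  induction hg using AddSubgroup.closure_induction with
  | mem g hg =>
    obtain ⟨Z, r, u, hZ, hr, -, rfl⟩ := hg
    refine comp_mem_radPow_one hZ (r ∘ₗ e.toLinearMap) (fun h => hr ?_) u
    have := h.comp e.symm.bijective
    convert this using 1
    ext x
    simp
  | zero => rw [LinearMap.zero_comp]; exact AddSubgroup.zero_mem _
  | add a b _ _ ha hb => rw [LinearMap.add_comp]; exact AddSubgroup.add_mem _ ha hb
  | neg a _ ha => rw [LinearMap.neg_comp]; exact AddSubgroup.neg_mem _ ha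

/-- Unfolds the nested closures into sums of maps starting with a single chain, to which the
Harada–Sai lemma applies. -/
theorem radPow_le_closure_radChain (k : ℕ) {W : ModuleCat.{u} Λ} (hW : P W) {g : W →ₗ[Λ] Y}
    (hg : g ∈ radPow P Y k W) : g ∈ AddSubgroup.closure {g : W →ₗ[Λ] Y |
      ∃ (Z : ModuleCat.{u} Λ) (f : W →ₗ[Λ] Z) (u : Z →ₗ[Λ] Y), RadChain P k W Z f ∧ u ∘ₗ f = g} := by
  induction k generalizing W with
  | zero => exact AddSubgroup.subset_closure ⟨W, LinearMap.id, g, .refl W hW, rfl⟩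
  | succ k ih =>
    refine (AddSubgroup.closure_le _).2 ?_ hg
    rintro _ ⟨Z, r, u, hZ, hr, hu, rfl⟩
    refine AddSubgroup.closure_induction (p := fun u _ => u ∘ₗ r ∈ AddSubgroup.closure _) ?_ ?_ ?_ ?_
      (ih hZ hu)
    · rintro _ ⟨Z', f, v, hf, rfl⟩
      exact AddSubgroup.subset_closure ⟨Z', f ∘ₗ r, v, .cons r f hW hr hf, rfl⟩
    · rw [LinearMap.zero_comp]; exact AddSubgroup.zero_mem _
    · intro a b _ _ ha hb
      rw [LinearMap.add_comp]; exact AddSubgroup.add_mem _ ha hb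
    · intro a _ ha
      rw [LinearMap.neg_comp]; exact AddSubgroup.neg_mem _ ha

theorem eq_zero_of_mem_radPow [IsArtinianRing Λ]
    (hP : ∀ X, P X → Module.Finite Λ X ∧ IsIndecomposable Λ X)
    {b : ℕ} (hb : ∀ X, P X → Module.length Λ X ≤ b) {W : ModuleCat.{u} Λ} (hW : P W)
    {g : W →ₗ[Λ] Y} (hg : g ∈ radPow P Y (2 ^ b - 1) W) : g = 0 := by
  have h := radPow_le_closure_radChain _ hW hg
  rw [← AddSubgroup.mem_bot (G := W →ₗ[Λ] Y)]
  refine (AddSubgroup.closure_le _).2 ?_ h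
  rintro _ ⟨Z, f, u, hf, rfl⟩
  rw [hf.eq_zero hP hb, LinearMap.comp_zero]
  exact AddSubgroup.zero_mem _

end RadicalPowers

/-! ### Bounded length implies finitely many indecomposable CM modules. -/

section Finiteness

variable {Λ ω : Type u} [Ring Λ] [AddCommGroup ω] [Module Λ ω]

variable (Λ ω) in
/-- The predicate of being an indecomposable Cohen-Macaulay module, on bundled modules. -/
abbrev IsCM (X : ModuleCat.{u} Λ) : Prop := IsIndecomposableCM Λ ω X

theorem IsCM.finite_and_indecomposable (X : ModuleCat.{u} Λ) (hX : IsCM Λ ω X) :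
    Module.Finite Λ X ∧ IsIndecomposable Λ X := ⟨hX.finite, hX.indecomposable⟩

theorem IsIndecomposableCM.exists_ne_zero {X : Type u} [AddCommGroup X] [Module Λ X]
    (hX : IsIndecomposableCM Λ ω X) : ∃ f : X →ₗ[Λ] ω, f ≠ 0 := by
  have := hX.indecomposable.1
  obtain ⟨x, hx⟩ := exists_ne (0 : X)
  obtain ⟨w, ε, d, hw, hε, -⟩ := hX.gorensteinProjective
  obtain ⟨I, i, p, hpi⟩ := hw 0
  by_contra! h
  have h1 : i (ε x) = 0 := by
    ext j
    exact LinearMap.congr_fun (h (Finsupp.lapply j ∘ₗ i ∘ₗ ε)) x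
  have h2 : p (i (ε x)) = ε x := LinearMap.congr_fun hpi _
  rw [h1, map_zero] at h2
  exact hx (hε (by rw [← h2, map_zero]))

variable [Module Λᵐᵒᵖ ω] [SMulCommClass Λ Λᵐᵒᵖ ω] [IsArtinAlgebra Λ]

/-- Unfold `g` through right almost split families `k` times. The list `L` collects the modules met
on the way, so a source outside it can only contribute nonbijective maps, which factor one level
further. -/
theorem IsDualizing.exists_finite_radChain (hω : IsDualizing Λ ω) (k : ℕ) (Z : ModuleCat.{u} Λ)
    (hZ : IsCM Λ ω Z) : ∃ L : Set (ModuleCat.{u} Λ), L.Finite ∧ ∀ X : ModuleCat.{u} Λ, IsCM Λ ω X →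
      ∀ g : X →ₗ[Λ] Z, (∃ Y ∈ L, Nonempty (X ≃ₗ[Λ] Y)) ∨ g ∈ AddSubgroup.closure
        {g : X →ₗ[Λ] Z | ∃ (X' : ModuleCat.{u} Λ) (h : X →ₗ[Λ] X') (f : X' →ₗ[Λ] Z),
          RadChain (IsCM Λ ω) k X' Z f ∧ f ∘ₗ h = g} := by
  induction k generalizing Z with
  | zero =>
    exact ⟨∅, Set.finite_empty, fun X _ g => .inr <| AddSubgroup.subset_closure
      ⟨Z, g, LinearMap.id, .refl Z hZ, rfl⟩⟩
  | succ k ih =>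
    obtain ⟨n, Y, p, hY, hp⟩ := hω.exists_right_almost_split Z hZ
    choose L hL hL' using fun i => ih (Y i) (hY i).1
    refine ⟨{Z} ∪ ⋃ i, L i, (Set.finite_singleton Z).union (Set.finite_iUnion hL),
      fun X hX g => ?_⟩
    by_cases hg : Function.Bijective g
    · exact .inl ⟨Z, .inl rfl, ⟨LinearEquiv.ofBijective g hg⟩⟩
    by_cases hXL : ∃ i, ∃ W ∈ L i, Nonempty (X ≃ₗ[Λ] W)
    · obtain ⟨i, W, hW, e⟩ := hXL
      exact .inl ⟨W, .inr (Set.mem_iUnion.2 ⟨i, hW⟩), e⟩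
    obtain ⟨h, rfl⟩ := hp X hX g hg
    refine .inr (AddSubgroup.sum_mem _ fun i _ => ?_)
    refine AddSubgroup.closure_induction
      (p := fun h _ => p i ∘ₗ h ∈ AddSubgroup.closure _) ?_ ?_ ?_ ?_
      ((hL' i X hX (h i)).resolve_left fun h => hXL ⟨i, h⟩)
    · rintro _ ⟨X', h', f, hf, rfl⟩
      exact AddSubgroup.subset_closure ⟨X', h', p i ∘ₗ f, hf.snoc (p i) hZ (hY i).2, rfl⟩
    · rw [LinearMap.comp_zero]; exact AddSubgroup.zero_mem _
    · intro a b _ _ ha hb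
      rw [LinearMap.comp_add]; exact AddSubgroup.add_mem _ ha hb
    · intro a _ ha
      rw [LinearMap.comp_neg]; exact AddSubgroup.neg_mem _ ha

/-- If the lengths of the indecomposable Cohen-Macaulay modules are bounded, there are only
finitely many of them. -/
theorem IsDualizing.algebraIsOfFiniteCMType (hω : IsDualizing Λ ω) {b : ℕ}
    (hb : ∀ X : ModuleCat.{u} Λ, IsCM Λ ω X → Module.length Λ X ≤ b) :
    AlgebraIsOfFiniteCMType Λ ω := by
  have := hω.finite
  obtain ⟨n, C, hC, ⟨e⟩⟩ := hω.exists_decomposition ω hω.extVanish_self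
  -- At depth `2 ^ b - 1` the chains vanish, so a module outside all the lists has only zero maps to
  -- the summands of `ω`.
  choose L hL hL' using fun i => hω.exists_finite_radChain (2 ^ b - 1) (C i) (hC i)
  have : Finite (⋃ i, L i) := Set.finite_iUnion hL
  obtain ⟨m, ⟨ψ⟩⟩ := Finite.exists_equiv_fin (⋃ i, L i)
  refine ⟨m, fun k => (ψ.symm k : ModuleCat.{u} Λ), fun N _ _ hN => ?_⟩
  obtain ⟨f, hf⟩ := hN.exists_ne_zero
  suffices H : ∃ i, ∃ Y ∈ L i, Nonempty (N ≃ₗ[Λ] Y) by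
    obtain ⟨i, Y, hY, hNY⟩ := H
    refine ⟨ψ ⟨Y, Set.mem_iUnion.2 ⟨i, hY⟩⟩, ?_⟩
    change Nonempty (N ≃ₗ[Λ] (ψ.symm (ψ ⟨Y, _⟩) : ModuleCat.{u} Λ))
    rwa [ψ.symm_apply_apply]
  by_contra! hcon
  refine hf (LinearMap.ext fun x => e.injective (funext fun i => ?_))
  have h := (hL' i (ModuleCat.of Λ N) hN (LinearMap.proj i ∘ₗ e.toLinearMap ∘ₗ f)).resolve_left
    fun ⟨Y, hY, ⟨e⟩⟩ => (hcon i Y hY).false e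
  have h0 : LinearMap.proj i ∘ₗ e.toLinearMap ∘ₗ f = 0 := by
    rw [← AddSubgroup.mem_bot (G := N →ₗ[Λ] C i)]
    refine (AddSubgroup.closure_le _).2 ?_ h
    rintro _ ⟨X', h', f', hf', rfl⟩
    rw [hf'.eq_zero IsCM.finite_and_indecomposable hb, LinearMap.zero_comp]
    exact AddSubgroup.zero_mem _
  refine (LinearMap.congr_fun h0 x).trans ?_
  rw [LinearMap.zero_apply, LinearMap.zero_apply, map_zero]
  rfl

end Finiteness

/-! ### Composition and finite sums. -/

section Sums

variable {Λ A B C ι : Type*} [Ring Λ] [AddCommGroup A] [Module Λ A] [AddCommGroup B] [Module Λ B]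
  [AddCommGroup C] [Module Λ C]

theorem linearMap_sum_comp (t : Finset ι) (g : ι → B →ₗ[Λ] C) (f : A →ₗ[Λ] B) :
    (∑ i ∈ t, g i) ∘ₗ f = ∑ i ∈ t, g i ∘ₗ f :=
  LinearMap.ext fun x => by simp [LinearMap.sum_apply]

theorem linearMap_comp_sum (t : Finset ι) (g : B →ₗ[Λ] C) (f : ι → A →ₗ[Λ] B) :
    g ∘ₗ ∑ i ∈ t, f i = ∑ i ∈ t, g ∘ₗ f i :=
  LinearMap.ext fun x => by simp [LinearMap.sum_apply]

end Sums

/-! ### Families of homomorphisms to `M` that are independent modulo the radical. -/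

section IndependentFamilies

variable {Λ : Type u} [Ring Λ] (P : ModuleCat.{u} Λ → Prop)
variable {M : Type u} [AddCommGroup M] [Module Λ M]
variable {T : Type u} {X : T → ModuleCat.{u} Λ} (μ : ∀ s, X s →ₗ[Λ] M)

/-- A set of homomorphisms to `M` is independent modulo the radical if its linear relations modulo
the radical have only nonbijective coefficients. -/
def IsIndepModRad (B : Set T) : Prop :=
  ∀ W : ModuleCat.{u} Λ, P W → ∀ t : Finset T, (t : Set T) ⊆ B → ∀ f : ∀ s, W →ₗ[Λ] X s,
    ∑ s ∈ t, μ s ∘ₗ f s ∈ radPow P M 1 W → ∀ s ∈ t, ¬ Function.Bijective (f s)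

/-- Independence is tested on finite subsets, so it passes to unions of chains. -/
theorem exists_maximal_isIndepModRad : ∃ B : Set T, Maximal (IsIndepModRad P μ) B := by
  refine zorn_subset {B | IsIndepModRad P μ B} fun c hc hchain =>
    ⟨⋃₀ c, fun W hW t ht f hf s hs => ?_, fun _ => Set.subset_sUnion_of_mem⟩
  obtain ⟨A, hA, -⟩ := ht hs
  obtain ⟨A, hA, htA⟩ := hchain.directedOn.exists_mem_subset_of_finite_of_subset_sUnion
    ⟨A, hA⟩ t.finite_toSet ht
  exact hc hA W hW t htA f hf s hs

/-- Composition with `π`, on the homomorphisms from `W`. -/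
def compHom {Q : Type u} [AddCommGroup Q] [Module Λ Q] (π : Q →ₗ[Λ] M) (W : ModuleCat.{u} Λ) :
    (W →ₗ[Λ] Q) →+ (W →ₗ[Λ] M) :=
  AddMonoidHom.mk' (fun g => π ∘ₗ g) fun _ _ => LinearMap.comp_add ..

open Classical in
/-- The homomorphism to `M` from the direct sum of the modules indexed by `B`. -/
noncomputable def sumMap (B : Set T) : (⨁ s : B, X s) →ₗ[Λ] M :=
  DirectSum.toModule Λ B M fun s => μ s

open Classical in
theorem sumMap_comp_lof (B : Set T) (s : B) :
    sumMap μ B ∘ₗ DirectSum.lof Λ B (fun s => X s) s = μ s :=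
  LinearMap.ext fun x => DirectSum.toModule_lof (φ := fun s : B => μ s) Λ s x

theorem comp_mem_range_sumMap {B : Set T} {s : T} (hs : s ∈ B) {W : ModuleCat.{u} Λ}
    (f : W →ₗ[Λ] X s) : μ s ∘ₗ f ∈ (compHom (sumMap μ B) W).range := by
  classical
  refine ⟨DirectSum.lof Λ B (fun s => X s) ⟨s, hs⟩ ∘ₗ f, ?_⟩
  change sumMap μ B ∘ₗ _ ∘ₗ f = _
  rw [← LinearMap.comp_assoc, sumMap_comp_lof]

variable {P μ}

/-- By `hrep` it suffices to treat `μ s`. If `s` is not in `B`, maximality gives a relation with a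
bijective coefficient; the coefficient at `s` is then bijective, for otherwise its term is radical
and can be dropped, against the independence of `B`. Solve the relation for `μ s`. -/
theorem mem_range_sup_radPow_one (hX : ∀ s, P (X s))
    (hrep : ∀ W, P W → ∀ m : W →ₗ[Λ] M, ∃ s, ∃ e : W ≃ₗ[Λ] X s, μ s ∘ₗ e.toLinearMap = m)
    {B : Set T} (hB : Maximal (IsIndepModRad P μ) B) {W : ModuleCat.{u} Λ} (hW : P W)
    (m : W →ₗ[Λ] M) : m ∈ (compHom (sumMap μ B) W).range ⊔ radPow P M 1 W := by
  classical
  obtain ⟨s, e, rfl⟩ := hrep W hW m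
  by_cases hs : s ∈ B
  · exact AddSubgroup.mem_sup_left (comp_mem_range_sumMap μ hs _)
  have hnot : ¬ IsIndepModRad P μ (insert s B) := fun h =>
    hs (hB.2 h (Set.subset_insert s B) (Set.mem_insert s B))
  unfold IsIndepModRad at hnot
  push Not at hnot
  obtain ⟨W', hW', t, ht, f, hf, s', hs', hbij⟩ := hnot
  have hsub : ∀ r ∈ t, r ≠ s → r ∈ B := fun r hr hrs => (ht hr).resolve_left hrs
  have hst : s ∈ t := by
    by_contra hst
    exact hB.1 W' hW' t (fun r hr => hsub r hr fun h => hst (h ▸ hr)) f hf s' hs' hbij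
  rw [← Finset.add_sum_erase t _ hst] at hf
  have hfs : Function.Bijective (f s) := by
    by_contra hfs
    refine hB.1 W' hW' (t.erase s) (fun r hr => hsub r (Finset.mem_of_mem_erase hr)
      (Finset.ne_of_mem_erase hr)) f ((AddSubgroup.add_mem_cancel_left _
        (comp_mem_radPow_one (hX s) (f s) hfs (μ s))).1 hf) s' (Finset.mem_erase.2 ⟨?_, hs'⟩) hbij
    rintro rfl
    exact hfs hbij
  let φ := e.trans (LinearEquiv.ofBijective (f s) hfs).symm
  have h1 : μ s ∘ₗ e.toLinearMap = (μ s ∘ₗ f s + ∑ r ∈ t.erase s, μ r ∘ₗ f r) ∘ₗ φ.toLinearMap +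
      -∑ r ∈ t.erase s, μ r ∘ₗ f r ∘ₗ φ.toLinearMap := by
    have h2 : f s ∘ₗ φ.toLinearMap = e.toLinearMap :=
      LinearMap.ext fun x => (LinearEquiv.ofBijective (f s) hfs).apply_symm_apply (e x)
    rw [LinearMap.add_comp, LinearMap.comp_assoc, h2, linearMap_sum_comp]
    simp only [LinearMap.comp_assoc]
    abel
  rw [h1]
  refine AddSubgroup.add_mem _ (AddSubgroup.mem_sup_right (radPow_one_comp_equiv hf φ))
    (AddSubgroup.mem_sup_left (AddSubgroup.neg_mem _ (AddSubgroup.sum_mem _ fun r hr => ?_)))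
  exact comp_mem_range_sumMap μ (hsub r (Finset.mem_of_mem_erase hr)
    (Finset.ne_of_mem_erase hr)) _

/-- Nakayama's argument: apply the decomposition again to the second factor `u` of a radical map `u
∘ₗ r`. -/
theorem mem_range_sup_radPow {Q : Type u} [AddCommGroup Q] [Module Λ Q] {π : Q →ₗ[Λ] M}
    (h : ∀ W, P W → ∀ m : W →ₗ[Λ] M, m ∈ (compHom π W).range ⊔ radPow P M 1 W) (k : ℕ)
    {W : ModuleCat.{u} Λ} (hW : P W) (m : W →ₗ[Λ] M) :
    m ∈ (compHom π W).range ⊔ radPow P M k W := by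
  induction k generalizing W with
  | zero => exact AddSubgroup.mem_sup_right (AddSubgroup.mem_top m)
  | succ k ih =>
    suffices H : radPow P M 1 W ≤ (compHom π W).range ⊔ radPow P M (k + 1) W from
      sup_le le_sup_left H (h W hW m)
    refine (AddSubgroup.closure_le _).2 ?_
    rintro _ ⟨Z, r, u, hZ, hr, -, rfl⟩
    obtain ⟨_, ⟨g, rfl⟩, v, hv, rfl⟩ := AddSubgroup.mem_sup.1 (ih hZ u)
    rw [LinearMap.add_comp]
    exact AddSubgroup.add_mem _ (AddSubgroup.mem_sup_left ⟨g ∘ₗ r, rfl⟩)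
      (AddSubgroup.mem_sup_right (comp_mem_radPow_succ hZ r hr hv))

/-- The hypothesis says that the kernel of composition with `π` equals its own radical, so it lies
in all radical powers. -/
theorem mem_radPow_of_comp_eq_zero {Q : Type u} [AddCommGroup Q] [Module Λ Q] {π : Q →ₗ[Λ] M}
    (h : ∀ W, P W → ∀ f : W →ₗ[Λ] Q, π ∘ₗ f = 0 → f ∈ AddSubgroup.closure
      {g : W →ₗ[Λ] Q | ∃ (Z : ModuleCat.{u} Λ) (r : W →ₗ[Λ] Z) (v : Z →ₗ[Λ] Q),
        P Z ∧ ¬ Function.Bijective r ∧ π ∘ₗ v = 0 ∧ v ∘ₗ r = g}) (k : ℕ)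
    {W : ModuleCat.{u} Λ} (hW : P W) (f : W →ₗ[Λ] Q) (hf : π ∘ₗ f = 0) :
    f ∈ radPow P Q k W := by
  induction k generalizing W with
  | zero => exact AddSubgroup.mem_top f
  | succ k ih =>
    refine (AddSubgroup.closure_le _).2 ?_ (h W hW f hf)
    rintro _ ⟨Z, r, v, hZ, hr, hv, rfl⟩
    exact comp_mem_radPow_succ hZ r hr (ih hZ v hv)

/-- A homomorphism from a finitely generated module to a direct sum involves finitely many
summands. -/
theorem exists_eq_sum_lof {ι : Type u} [DecidableEq ι] {X : ι → ModuleCat.{u} Λ} {W : Type u} [AddCommGroup W]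
    [Module Λ W] [Module.Finite Λ W] (f : W →ₗ[Λ] ⨁ i, X i) : ∃ t : Finset ι,
      f = ∑ i ∈ t, DirectSum.lof Λ ι (fun i => X i) i ∘ₗ
        DirectSum.component Λ ι (fun i => X i) i ∘ₗ f := by
  classical
  obtain ⟨S, hS⟩ := Module.Finite.fg_top (R := Λ) (M := W)
  refine ⟨S.biUnion fun w => DFinsupp.support (f w), LinearMap.ext_on hS fun w hw => ?_⟩
  rw [LinearMap.sum_apply]
  have h1 : f w = ∑ i ∈ DFinsupp.support (f w), DirectSum.lof Λ ι (fun i => X i) i (f w i) :=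
    (DirectSum.sum_support_of (f w)).symm
  refine h1.trans (Finset.sum_subset (Finset.subset_biUnion_of_mem
    (fun w => DFinsupp.support (f w)) hw) fun i _ hi => ?_)
  rw [DFinsupp.notMem_support_iff.1 hi, map_zero]

end IndependentFamilies

/-! ### Decomposition of Gorenstein projective modules. -/

section Decomposition

variable {Λ ω : Type u} [Ring Λ] [AddCommGroup ω] [Module Λ ω]

theorem IsIndecomposableCM.of_linearEquiv {X Y : Type u} [AddCommGroup X] [Module Λ X]
    [AddCommGroup Y] [Module Λ Y] (h : IsIndecomposableCM Λ ω X) (e : X ≃ₗ[Λ] Y) :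
    IsIndecomposableCM Λ ω Y := by
  obtain ⟨w, ε, d, hw, hε, hεd, hd⟩ := h.gorensteinProjective
  have := h.finite
  refine ⟨.equiv e, ⟨w, ε ∘ₗ e.symm.toLinearMap, d, hw, hε.comp e.symm.injective, fun y => ?_, hd⟩,
    h.indecomposable.of_linearEquiv e⟩
  exact (hεd y).trans (e.symm.surjective.exists (p := fun x => ε x = y))

variable [Module Λᵐᵒᵖ ω] [SMulCommClass Λ Λᵐᵒᵖ ω] [IsArtinAlgebra Λ]
variable {M : Type u} [AddCommGroup M] [Module Λ M]

theorem IsDualizing.exists_lift (hω : IsDualizing Λ ω) {Q : Type u} [AddCommGroup Q] [Module Λ Q]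
    {π : Q →ₗ[Λ] M} (h : ∀ W, IsCM Λ ω W → ∀ m : W →ₗ[Λ] M, ∃ g, π ∘ₗ g = m) (Y : Type u)
    [AddCommGroup Y] [Module Λ Y] [Module.Finite Λ Y] (hY : ExtVanish Λ Y ω 0) (m : Y →ₗ[Λ] M) :
    ∃ g : Y →ₗ[Λ] Q, π ∘ₗ g = m := by
  obtain ⟨n, C, hC, ⟨e⟩⟩ := hω.exists_decomposition Y hY
  choose g hg using fun j => h (C j) (hC j)
    (m ∘ₗ e.symm.toLinearMap ∘ₗ LinearMap.single Λ (fun j => C j) j)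
  refine ⟨LinearMap.lsum Λ (fun j => C j) ℕ g ∘ₗ e.toLinearMap, LinearMap.ext fun y => ?_⟩
  obtain ⟨y, rfl⟩ := e.symm.surjective y
  change π (LinearMap.lsum Λ (fun j => C j) ℕ g (e (e.symm y))) = _
  rw [e.apply_symm_apply, LinearMap.lsum_apply, LinearMap.sum_apply, map_sum]
  conv_rhs => rw [← Finset.univ_sum_single y, map_sum, map_sum]
  exact Finset.sum_congr rfl fun j _ => LinearMap.congr_fun (hg j) (y j)

theorem IsDualizing.eq_zero_of_forall (hω : IsDualizing Λ ω) {Q : Type u} [AddCommGroup Q]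
    [Module Λ Q] {π : Q →ₗ[Λ] M}
    (h : ∀ W, IsCM Λ ω W → ∀ g : W →ₗ[Λ] Q, π ∘ₗ g = 0 → g = 0) (Y : Type u)
    [AddCommGroup Y] [Module Λ Y] [Module.Finite Λ Y] (hY : ExtVanish Λ Y ω 0) (g : Y →ₗ[Λ] Q)
    (hg : π ∘ₗ g = 0) : g = 0 := by
  obtain ⟨n, C, hC, ⟨e⟩⟩ := hω.exists_decomposition Y hY
  have h0 : g ∘ₗ e.symm.toLinearMap = 0 := LinearMap.pi_ext' fun j =>
    (h (C j) (hC j) (g ∘ₗ e.symm.toLinearMap ∘ₗ LinearMap.single Λ (fun j => C j) j) (by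
      rw [← LinearMap.comp_assoc, hg, LinearMap.zero_comp])).trans (LinearMap.zero_comp _).symm
  refine LinearMap.ext fun y => ?_
  have := LinearMap.congr_fun h0 (e y)
  rwa [LinearMap.comp_apply, LinearEquiv.coe_coe, e.symm_apply_apply] at this

/-- The flatness argument. A map `f` killed by `sumMap μ B` is a relation whose coefficients are
nonbijective by independence. Correcting the inclusion `σ` of the finitely many summands involved by
a suitable `v` with `v ∘ₗ F = 0` turns `f` into a combination of these coefficients with maps that
are themselves killed by `sumMap μ B`. -/
theorem IsDualizing.mem_closure_of_sumMap_comp_eq_zero (hω : IsDualizing Λ ω)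
    (hM : IsGorensteinProjective Λ ω M) {T : Type u} {X : T → ModuleCat.{u} Λ}
    {μ : ∀ s, X s →ₗ[Λ] M} (hX : ∀ s, IsCM Λ ω (X s)) {B : Set T}
    (hB : IsIndepModRad (IsCM Λ ω) μ B)
    (hlift : ∀ W, IsCM Λ ω W → ∀ m : W →ₗ[Λ] M, ∃ g, sumMap μ B ∘ₗ g = m)
    (W : ModuleCat.{u} Λ) (hW : IsCM Λ ω W) (f : W →ₗ[Λ] ⨁ s : B, X s)
    (hf : sumMap μ B ∘ₗ f = 0) : f ∈ AddSubgroup.closure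
      {g : W →ₗ[Λ] ⨁ s : B, X s | ∃ (Z : ModuleCat.{u} Λ) (r : W →ₗ[Λ] Z)
        (v : Z →ₗ[Λ] ⨁ s : B, X s), IsCM Λ ω Z ∧ ¬ Function.Bijective r ∧
          sumMap μ B ∘ₗ v = 0 ∧ v ∘ₗ r = g} := by
  classical
  have := hW.finite
  have (s : T) : Module.Finite Λ (X s) := (hX s).finite
  obtain ⟨t, ht⟩ := exists_eq_sum_lof (X := fun s : B => X s) f
  let c (s : B) : W →ₗ[Λ] X s := DirectSum.component Λ B (fun s => X s) s ∘ₗ f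
  have hsum : ∑ s ∈ t, μ s ∘ₗ c s = 0 := by
    rw [← hf]
    conv_rhs => rw [ht]
    rw [linearMap_comp_sum]
    refine Finset.sum_congr rfl fun s _ => ?_
    rw [← sumMap_comp_lof μ B s]
    rfl
  have hc : ∀ s ∈ t, ¬ Function.Bijective (c s) := fun s hs => by
    let f' (r : T) : W →ₗ[Λ] X r := if h : r ∈ B then c ⟨r, h⟩ else 0
    have hf' (r : B) : f' r = c r := dif_pos r.2
    rw [← hf']
    refine hB W hW (t.map (Function.Embedding.subtype _)) (fun r hr => ?_) f' ?_ s
      (Finset.mem_map_of_mem _ hs)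
    · obtain ⟨r, -, rfl⟩ := Finset.mem_map.1 hr
      exact r.2
    · rw [Finset.sum_map]
      have : ∑ s ∈ t, μ s ∘ₗ f' s = 0 := by simp only [hf', hsum]
      exact this ▸ AddSubgroup.zero_mem _
  let F : W →ₗ[Λ] ∀ s : t, X s := LinearMap.pi fun s => c s
  let σ : (∀ s : t, X s) →ₗ[Λ] ⨁ s : B, X s :=
    ∑ s : t, DirectSum.lof Λ B (fun s => X s) s ∘ₗ LinearMap.proj s
  have hσ : σ ∘ₗ F = f := by
    conv_rhs => rw [ht, ← Finset.sum_coe_sort]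
    rw [linearMap_sum_comp]
    rfl
  -- The map induced on the cokernel of `F` factors through a CM module, from which it lifts to the
  -- direct sum. Hence `v` agrees with `σ` after `sumMap μ B` but vanishes on the range of `F`.
  obtain ⟨Y, a, b, _, hY, hab⟩ := hω.exists_factor M ((∀ s : t, X s) ⧸ LinearMap.range F) hM
    ((LinearMap.range F).liftQ (sumMap μ B ∘ₗ σ) (by
      rintro _ ⟨w, rfl⟩
      change sumMap μ B ((σ ∘ₗ F) w) = 0
      rw [hσ]
      exact LinearMap.congr_fun hf w))
  obtain ⟨g, hg⟩ := hω.exists_lift hlift Y hY b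
  let v : (∀ s : t, X s) →ₗ[Λ] ⨁ s : B, X s := g ∘ₗ a ∘ₗ (LinearMap.range F).mkQ
  have hv : sumMap μ B ∘ₗ v = sumMap μ B ∘ₗ σ := by
    change sumMap μ B ∘ₗ g ∘ₗ a ∘ₗ _ = _
    rw [← LinearMap.comp_assoc, hg, ← LinearMap.comp_assoc, hab, Submodule.liftQ_mkQ]
  have hvF : v ∘ₗ F = 0 := by
    change g ∘ₗ a ∘ₗ (LinearMap.range F).mkQ ∘ₗ F = 0
    rw [LinearMap.range_mkQ_comp, LinearMap.comp_zero, LinearMap.comp_zero]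
  have key : f = ∑ s : t, ((σ - v) ∘ₗ LinearMap.single Λ (fun s : t => X s) s) ∘ₗ c s := by
    have h1 : (σ - v) ∘ₗ F = f := by rw [LinearMap.sub_comp, hσ, hvF, sub_zero]
    rw [← h1]
    refine LinearMap.ext fun w => ?_
    rw [LinearMap.comp_apply, ← Finset.univ_sum_single (F w), map_sum, LinearMap.sum_apply]
    rfl
  rw [key]
  refine AddSubgroup.sum_mem _ fun s _ => AddSubgroup.subset_closure
    ⟨X s, c s, _, hX s, hc s s.2, ?_, rfl⟩
  rw [← LinearMap.comp_assoc, LinearMap.comp_sub, hv, sub_self, LinearMap.zero_comp]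

/-- The homomorphisms to `M` from a set of representatives of the finitely generated modules with
the property `P`. -/
def RepHom (P : ModuleCat.{u} Λ → Prop) (M : Type u) [AddCommGroup M] [Module Λ M] : Type u :=
  Σ d : {d : Σ n : ℕ, Submodule Λ (Fin n → Λ) // P (ModuleCat.of Λ ((Fin d.1 → Λ) ⧸ d.2))},
    ((Fin d.1.1 → Λ) ⧸ d.1.2) →ₗ[Λ] M

/-- The domain of a homomorphism from a set of representatives. -/
abbrev RepHom.source {P : ModuleCat.{u} Λ → Prop} (s : RepHom P M) : ModuleCat.{u} Λ :=
  ModuleCat.of Λ ((Fin s.1.1.1 → Λ) ⧸ s.1.1.2)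

/-- If the lengths of the indecomposable Cohen-Macaulay modules are bounded, every Gorenstein
projective module is a direct sum of indecomposable Cohen-Macaulay modules. -/
theorem IsDualizing.exists_equiv_directSum (hω : IsDualizing Λ ω) {b : ℕ}
    (hb : ∀ X : ModuleCat.{u} Λ, IsCM Λ ω X → Module.length Λ X ≤ b)
    (hM : IsGorensteinProjective Λ ω M) : ∃ (I : Type u) (X : I → ModuleCat.{u} Λ),
      (∀ i, IsIndecomposableCM Λ ω (X i)) ∧ Nonempty (M ≃ₗ[Λ] ⨁ i, X i) := by
  let μ (s : RepHom (IsCM Λ ω) M) : s.source →ₗ[Λ] M := s.2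
  have hX (s : RepHom (IsCM Λ ω) M) : IsCM Λ ω s.source := s.1.2
  have hrep : ∀ W, IsCM Λ ω W → ∀ m : W →ₗ[Λ] M, ∃ s : RepHom (IsCM Λ ω) M,
      ∃ e : W ≃ₗ[Λ] s.source, μ s ∘ₗ e.toLinearMap = m := fun W hW m => by
    have := hW.finite
    obtain ⟨n, p, hp⟩ := Module.Finite.exists_fin' Λ W
    let e : ((Fin n → Λ) ⧸ LinearMap.ker p) ≃ₗ[Λ] W := p.quotKerEquivOfSurjective hp
    exact ⟨⟨⟨⟨n, LinearMap.ker p⟩, hW.of_linearEquiv e.symm⟩, m ∘ₗ e.toLinearMap⟩, e.symm,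
      LinearMap.ext fun w => congrArg m (e.apply_symm_apply w)⟩
  obtain ⟨B, hB⟩ := exists_maximal_isIndepModRad (IsCM Λ ω) μ
  have hlift : ∀ W, IsCM Λ ω W → ∀ m : W →ₗ[Λ] M, ∃ g, sumMap μ B ∘ₗ g = m := fun W hW m => by
    obtain ⟨_, ⟨g, rfl⟩, r, hr, rfl⟩ := AddSubgroup.mem_sup.1 (mem_range_sup_radPow
      (fun W hW m => mem_range_sup_radPow_one hX hrep hB hW m) (2 ^ b - 1) hW m)
    rw [eq_zero_of_mem_radPow IsCM.finite_and_indecomposable hb hW hr, add_zero]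
    exact ⟨g, rfl⟩
  have hinj : ∀ W, IsCM Λ ω W → ∀ g : W →ₗ[Λ] ⨁ s : B, RepHom.source (s : RepHom (IsCM Λ ω) M),
      sumMap μ B ∘ₗ g = 0 → g = 0 := fun W hW g hg =>
    eq_zero_of_mem_radPow IsCM.finite_and_indecomposable hb hW (mem_radPow_of_comp_eq_zero
      (hω.mem_closure_of_sumMap_comp_eq_zero hM hX hB.1 hlift) (2 ^ b - 1) hW g hg)
  -- As `Λ` is CM, bijectivity on homomorphisms from CM modules includes bijectivity on `Hom(Λ, -)`,
  -- that is, on elements.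
  have hΛ : ExtVanish Λ Λ ω 0 := extVanish_of_projective
  refine ⟨B, fun s => RepHom.source (s : RepHom (IsCM Λ ω) M), fun s => hX s,
    ⟨(LinearEquiv.ofBijective (sumMap μ B) ⟨?_, fun x => ?_⟩).symm⟩⟩
  · refine (injective_iff_map_eq_zero _).2 fun x hx => ?_
    have := hω.eq_zero_of_forall hinj Λ hΛ (LinearMap.toSpanSingleton Λ _ x)
      (LinearMap.ext_ring (by simp [hx]))
    simpa using LinearMap.congr_fun this 1
  · obtain ⟨g, hg⟩ := hω.exists_lift hlift Λ hΛ (LinearMap.toSpanSingleton Λ _ x)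
    exact ⟨g 1, by simpa using LinearMap.congr_fun hg 1⟩

theorem IsDualizing.isOfFiniteCMType (hω : IsDualizing Λ ω) {b : ℕ}
    (hb : ∀ X : ModuleCat.{u} Λ, IsCM Λ ω X → Module.length Λ X ≤ b)
    (hM : IsGorensteinProjective Λ ω M) : IsOfFiniteCMType Λ ω M := by
  classical
  obtain ⟨I, X, hX, ⟨e⟩⟩ := hω.exists_equiv_directSum hb hM
  obtain ⟨n, C, hC⟩ := hω.algebraIsOfFiniteCMType hb
  -- The list `C` may contain modules that are not indecomposable CM; these are discarded.
  obtain ⟨m, ⟨ψ⟩⟩ := Finite.exists_equiv_fin {j // IsIndecomposableCM Λ ω (C j)}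
  have key (i : I) : ∃ k : Fin m, Nonempty (X i ≃ₗ[Λ] C (ψ.symm k)) := by
    obtain ⟨j, ⟨f⟩⟩ := hC (X i) (hX i)
    refine ⟨ψ ⟨j, (hX i).of_linearEquiv f⟩, ?_⟩
    rw [ψ.symm_apply_apply]
    exact ⟨f⟩
  choose c hc using key
  exact ⟨m, fun k => C (ψ.symm k), I, c, fun k => (ψ.symm k).2,
    ⟨e.trans (DFinsupp.mapRange.linearEquiv fun i => (hc i).some)⟩⟩

end Decomposition
end CMArtin

theorem theorem7p5 {R : Type*} {Λ ω : Type u} [CommRing R] [IsArtinianRing R] [Ring Λ] [Algebra R Λ]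
    [Module.Finite R Λ] [AddCommGroup ω] [Module Λ ω] [Module Λᵐᵒᵖ ω] [SMulCommClass Λ Λᵐᵒᵖ ω]
    (hω : CMArtin.IsDualizing Λ ω) :
    (∀ (M : Type u) [AddCommGroup M] [Module Λ M],
      CMArtin.IsGorensteinProjective Λ ω M → ¬ CMArtin.IsOfFiniteCMType Λ ω M →
        ∀ b : ℕ, ∃ N : ModuleCat.{u} Λ, CMArtin.IsIndecomposableCM Λ ω N ∧
          (b : ℕ∞) < Module.length Λ N ∧ Module.length Λ N < ⊤) ∧
    ((∃ b : ℕ, ∀ N : ModuleCat.{u} Λ, CMArtin.IsIndecomposableCM Λ ω N →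
        Module.length Λ N ≤ (b : ℕ∞)) →
      CMArtin.AlgebraIsOfFiniteCMType Λ ω) := by
  have := CMArtin.IsArtinAlgebra.of_algebra R (Λ := Λ)
  refine ⟨fun M _ _ hM hnot b => ?_, fun ⟨b, hb⟩ => hω.algebraIsOfFiniteCMType hb⟩
  -- Finitely generated modules have finite length, so if no `N` is as required, then `b` bounds all
  -- lengths.
  by_contra! h
  refine hnot (hω.isOfFiniteCMType (b := b) (fun N hN => ?_) hM)
  have := hN.finite
  exact not_lt.1 fun hlt => Module.length_ne_top (top_le_iff.1 (h N hN hlt))
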